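/- Let $d\ge 1$, let $J:\mathbb Z^d\to[0,\infty)$ be symmetric ($J(-x)=J(x)$ for all $x$) and integrable ($\sum_{x\in\mathbb Z^d}J(x)<\infty$), and suppose that there exist real numbers $\alpha<d/4$, $c>0$ and $r_0<\infty$ such that $J(x)\ge c\|x\|_1^{-d-\alpha}$ for every $x\in\mathbb Z^d$ with $\|x\|_1\ge r_0$, where $\|x\|_1=\sum_i|x_i|$ (at $x=0$ this condition is not imposed). For $\beta\ge 0$ let $\mathbf P_\beta$ be the law of long-range percolation: the random graph with vertex set $\mathbb Z^d$ in which each edge $\{x,y\}$, $x\ne y$, is included independently with probability $1-e^{-\beta J(y-x)}$. Clusters are the connected components of this graph, $K_0$ is the cluster of the origin, and $\beta_c\in[0,\infty]$ is the supremum of all $\beta\ge 0$ such that $\mathbf P_\beta$-almost surely there is no infinite cluster. Then there exists a constant $C$ (which may depend on $d$, $J$, $\alpha$, $c$, $r_0$) such that $$\mathbf P_\beta(|K_0|\ge n)\le C\,n^{-(d-4\alpha)/(4d)}$$ for every real $\beta$ with $0\le\beta\le\beta_c$ and every integer $n\ge 1$. In particular, $\beta_c<\infty$ and there are $\mathbf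 P_{\beta_c}$-almost surely no infinite clusters. -/

import Mathlib

open MeasureTheory ProbabilityTheory
open scoped NNReal ENNReal

namespace LongRange

/-- The vertex set `ℤ^d`. -/
abbrev Lattice (d : ℕ) : Type := Fin d → ℤ

/-- The `ℓ¹` norm on `ℤ^d`, as a real number. -/
def l1norm {d : ℕ} (x : Lattice d) : ℝ := ∑ i, |(x i : ℝ)|

/-- A symmetric, integrable function `J : ℤ^d → [0,∞)`. -/
structure Intensity (d : ℕ) where
  /-- the underlying function -/
  toFun : Lattice d → ℝ
  nonneg : ∀ x, 0 ≤ toFun x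
  symm : ∀ x, toFun (-x) = toFun x
  summable : Summable toFun

instance {d : ℕ} : CoeFun (Intensity d) (fun _ => Lattice d → ℝ) := ⟨Intensity.toFun⟩

/-- The weight `J (y - x)` of the unordered pair `{x, y}`. -/
def edgeWeight {d : ℕ} (J : Intensity d) : Sym2 (Lattice d) → ℝ :=
  Sym2.lift ⟨fun x y => J (y - x), fun x y => by
    change J (y - x) = J (x - y)
    rw [← J.symm (y - x), neg_sub]⟩

lemma edgeWeight_nonneg {d : ℕ} (J : Intensity d) (e : Sym2 (Lattice d)) :
    0 ≤ edgeWeight J e := by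
  induction e with
  | h x y => exact J.nonneg (y - x)

/-- The probability `1 - exp (-β J (y - x))` that the pair `{x, y}` is included. -/
noncomputable def inclusionProb {d : ℕ} (J : Intensity d) (β : ℝ≥0) (e : Sym2 (Lattice d)) :
    unitInterval :=
  ⟨1 - Real.exp (-((β : ℝ) * edgeWeight J e)), by
    have h : 0 ≤ (β : ℝ) * edgeWeight J e := mul_nonneg β.coe_nonneg (edgeWeight_nonneg J e)
    have h1 : Real.exp (-((β : ℝ) * edgeWeight J e)) ≤ 1 := Real.exp_le_one_iff.2 (by linarith)
    have h2 := Real.exp_pos (-((β : ℝ) * edgeWeight J e))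
    constructor <;> linarith⟩

/-- A percolation configuration records, for each unordered pair, whether it is included. The
degenerate pairs `{x, x}` also carry a coordinate, but it has no effect on the graph below. -/
abbrev Config (d : ℕ) : Type := Sym2 (Lattice d) → Bool

/-- The law of long-range percolation with intensity `J` at parameter `β`: each pair is included
independently with its inclusion probability. -/
noncomputable def percolation {d : ℕ} (J : Intensity d) (β : ℝ≥0) : Measure (Config d) :=
  Measure.infinitePi (fun e => bernoulliMeasure true false (inclusionProb J β e))

/-- The random graph on `ℤ^d`: distinct `x`, `y` are adjacent iff `{x, y}` is included. -/
def openGraph {d : ℕ} (ω : Config d) : SimpleGraph (Lattice d) :=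
  SimpleGraph.fromEdgeSet {e | ω e = true}

/-- The cluster of `x`: the set of vertices in its connected component. -/
def cluster {d : ℕ} (ω : Config d) (x : Lattice d) : Set (Lattice d) :=
  {y | (openGraph ω).Reachable x y}

/-- The law at parameter `β` is supported on configurations with no infinite clusters. -/
def NoInfiniteCluster {d : ℕ} (J : Intensity d) (β : ℝ≥0) : Prop :=
  ∀ᵐ ω ∂(percolation J β), ∀ x, (cluster ω x).Finite

/-- The critical parameter `β_c(J) ∈ [0,∞]`: the supremum of those `β ≥ 0` for which there are
almost surely no infinite clusters. -/
noncomputable def criticalParameter {d : ℕ} (J : Intensity d) : ℝ≥0∞ :=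
  ⨆ (β : ℝ≥0) (_ : NoInfiniteCluster J β), (β : ℝ≥0∞)

end LongRange

/-!
The proof works with percolation on finite sets `Λ ⊆ ℤ^d`, where every probability is a finite sum,
and passes to the lattice only at the end. Write `θ = (d - 4α) / (4d)`. There are three ingredients.

*The two-ghost inequality* (`twoGhost_inequality`), in the tradition of Aizenman, Kesten and Newman:
the sum over the pairs `{x, y}` in `Λ` of `J (y - x)` times the probability that `x` and `y` lie in
distinct clusters of size at least `n` is at most a constant times `|Λ| n^(-1/2)`.
Give each pair a centred variable: `J e` if it is closed, and `-a e` with `p e * a e = (1 - p e) * J e`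
if it is open, where `p e` is the probability that it is open. Summing these over
the pairs touching a cluster, weighting by `g |K| = 1 - exp (-h |K|)` and taking expectations, only
the pairs that join distinct clusters survive, with weight `g |K| * g |K'|`, because
`g m + g n - g (m + n) = g m * g n` (`sum_mul_expect_ghostPair`). On the other hand the sum over the
pairs touching a cluster `K` is sub-Gaussian with variance of order `|K|`: its exponential moments
compare the law of the cluster with its law after tilting the parameter of each pair, and both
laws have total mass one (`expect_exp_clusterFluctuation_le`). A sum over scales of `|K|` then gives
the inequality with `h ≍ 1 / n`.

*Sharpness* (`expect_clusterSize_le`, `le_expect_hitInd`, `exists_boundaryFlow_le`), following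
Duminil-Copin and Tassion: for `β < β_c` the expected cluster size is finite. It serves only as an
a priori bound: the tail is at most `A n^(-θ)` for some unspecified `A`.

*Bootstrap* (`volumeTail_sq_le`, `volumeTail_le_of_bounded`): let `Q n` be the tail. By the Harris
inequality, `Q n ^ 2` is at most the probability that `0` and `z` are connected plus the probability
that they lie in distinct clusters of size at least `n`. Averaging over the `r^d` points `z` of a
box at distance of order `r`, the first term becomes at most `r^(-d) ∑_{k ≤ r^d} Q k`, and the
second at most a constant times `r^α n^(-1/2)` by the two-ghost inequality. If `Q k ≤ A k^(-θ)` for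
all `k`, the choice `r^d ≍ n^2` gives `Q n ^ 2 ≤ (2 A + K) n^(-2θ)` with `K` independent of `A`, so
that the optimal `A` satisfies `A ^ 2 ≤ 2 A + K`. Hence `A` is bounded uniformly for `β` away from
`0`, and by monotonicity and continuity in `β` for all `β ≤ β_c`.

Letting `n → ∞`, there is no infinite cluster at `β_c`. As `β → ∞` the origin is connected to any
given number of points with high probability, so a bound uniform in `β` is impossible and `β_c` is
finite.
-/

namespace LongRange

open scoped Classical

set_option linter.unusedSectionVars false

/-! ### Finite products of Bernoulli measures -/

section Expectation

variable {α : Type*} [DecidableEq α]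

/-- The probability that the set of open elements of `E` is `F`, when each `e ∈ E` is open
independently with probability `p e`. -/
noncomputable def bernoulliWeight (p : α → ℝ) (E F : Finset α) : ℝ :=
  ∏ e ∈ E, if e ∈ F then p e else 1 - p e

/-- The expectation of `f`, evaluated at the random subset of `E` that contains each `e ∈ E`
independently with probability `p e`. -/
noncomputable def expect (p : α → ℝ) (E : Finset α) (f : Finset α → ℝ) : ℝ :=
  ∑ F ∈ E.powerset, bernoulliWeight p E F * f F

lemma expect_empty (p : α → ℝ) (f : Finset α → ℝ) : expect p ∅ f = f ∅ := by
  simp [expect, bernoulliWeight]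

lemma expect_insert (p : α → ℝ) {e : α} {E : Finset α} (he : e ∉ E) (f : Finset α → ℝ) :
    expect p (insert e E) f =
      (1 - p e) * expect p E f + p e * expect p E (fun F => f (insert e F)) := by
  unfold expect
  rw [Finset.sum_powerset_insert he, Finset.mul_sum, Finset.mul_sum]
  congr 1
  · refine Finset.sum_congr rfl fun F hF => ?_
    have : e ∉ F := fun h => he (Finset.mem_powerset.1 hF h)
    simp only [bernoulliWeight, Finset.prod_insert he, this, if_false]
    ring
  · refine Finset.sum_congr rfl fun F hF => ?_
    have h2 : ∏ x ∈ E, (if x ∈ insert e F then p x else 1 - p x) =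
        ∏ x ∈ E, (if x ∈ F then p x else 1 - p x) := by
      refine Finset.prod_congr rfl fun x hx => ?_
      have : x ≠ e := fun h => he (h ▸ hx)
      simp [this]
    simp only [bernoulliWeight, Finset.prod_insert he, Finset.mem_insert_self, if_true, h2]
    ring

lemma expect_erase (p : α → ℝ) {e : α} {E : Finset α} (he : e ∈ E) (f : Finset α → ℝ) :
    expect p E f = (1 - p e) * expect p (E.erase e) f +
      p e * expect p (E.erase e) (fun F => f (insert e F)) := by
  conv_lhs => rw [← Finset.insert_erase he]
  exact expect_insert p (Finset.notMem_erase e E) f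

lemma expect_congr {p q : α → ℝ} {E : Finset α} {f g : Finset α → ℝ}
    (hp : ∀ e ∈ E, p e = q e) (h : ∀ F ⊆ E, f F = g F) : expect p E f = expect q E g := by
  unfold expect
  refine Finset.sum_congr rfl fun F hF => ?_
  rw [h F (Finset.mem_powerset.1 hF)]
  congr 1
  exact Finset.prod_congr rfl fun e he => by rw [hp e he]

lemma expect_congr_fun {p : α → ℝ} {E : Finset α} {f g : Finset α → ℝ}
    (h : ∀ F ⊆ E, f F = g F) : expect p E f = expect p E g :=
  expect_congr (fun _ _ => rfl) h

lemma expect_add (p : α → ℝ) (E : Finset α) (f g : Finset α → ℝ) :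
    expect p E (fun F => f F + g F) = expect p E f + expect p E g := by
  simp only [expect, mul_add, Finset.sum_add_distrib]

lemma expect_sub (p : α → ℝ) (E : Finset α) (f g : Finset α → ℝ) :
    expect p E (fun F => f F - g F) = expect p E f - expect p E g := by
  simp only [expect, mul_sub, Finset.sum_sub_distrib]

lemma expect_const_mul (p : α → ℝ) (E : Finset α) (c : ℝ) (f : Finset α → ℝ) :
    expect p E (fun F => c * f F) = c * expect p E f := by
  simp only [expect, Finset.mul_sum]
  exact Finset.sum_congr rfl fun F _ => by ring

lemma expect_mul_const (p : α → ℝ) (E : Finset α) (c : ℝ) (f : Finset α → ℝ) :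
    expect p E (fun F => f F * c) = expect p E f * c := by
  simp only [expect, Finset.sum_mul]
  exact Finset.sum_congr rfl fun F _ => by ring

lemma expect_sum {ι : Type*} (p : α → ℝ) (E : Finset α) (s : Finset ι)
    (f : ι → Finset α → ℝ) :
    expect p E (fun F => ∑ i ∈ s, f i F) = ∑ i ∈ s, expect p E (f i) := by
  simp only [expect, Finset.mul_sum]
  exact Finset.sum_comm

lemma expect_const (p : α → ℝ) (E : Finset α) (c : ℝ) : expect p E (fun _ => c) = c := by
  induction E using Finset.induction_on with
  | empty => exact expect_empty _ _
  | insert e E he ih => rw [expect_insert p he, ih]; ring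

lemma bernoulliWeight_nonneg {p : α → ℝ} {E : Finset α}
    (hp : ∀ e ∈ E, 0 ≤ p e ∧ p e ≤ 1) (F : Finset α) : 0 ≤ bernoulliWeight p E F := by
  refine Finset.prod_nonneg fun e he => ?_
  have := hp e he
  split_ifs <;> linarith

lemma expect_le_expect {p : α → ℝ} {E : Finset α} {f g : Finset α → ℝ}
    (hp : ∀ e ∈ E, 0 ≤ p e ∧ p e ≤ 1) (h : ∀ F ⊆ E, f F ≤ g F) :
    expect p E f ≤ expect p E g :=
  Finset.sum_le_sum fun F hF =>
    mul_le_mul_of_nonneg_left (h F (Finset.mem_powerset.1 hF)) (bernoulliWeight_nonneg hp F)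

lemma expect_nonneg {p : α → ℝ} {E : Finset α} {f : Finset α → ℝ}
    (hp : ∀ e ∈ E, 0 ≤ p e ∧ p e ≤ 1) (h : ∀ F ⊆ E, 0 ≤ f F) : 0 ≤ expect p E f := by
  have := expect_le_expect hp h
  rwa [expect_const] at this

/-- Disjoint sets of edges are independent (Fubini). -/
lemma expect_union (p : α → ℝ) {E₁ E₂ : Finset α} (h : Disjoint E₁ E₂) (f : Finset α → ℝ) :
    expect p (E₁ ∪ E₂) f = expect p E₁ (fun F₁ => expect p E₂ (fun F₂ => f (F₁ ∪ F₂))) := by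
  induction E₁ using Finset.induction_on generalizing f with
  | empty => simp [expect_empty]
  | insert e E₁ he ih =>
    have hd : Disjoint E₁ E₂ := h.mono_left (Finset.subset_insert e E₁)
    have he2 : e ∉ E₂ := Finset.disjoint_left.1 h (Finset.mem_insert_self e E₁)
    have : e ∉ E₁ ∪ E₂ := by simp [he, he2]
    rw [Finset.insert_union, expect_insert p this, ih hd, ih hd, expect_insert p he]
    simp only [Finset.insert_union]

/-- An observable that only looks at `E₁` has the same expectation in any larger set. -/
lemma expect_local (p : α → ℝ) {E₁ E : Finset α} (h : E₁ ⊆ E) {f : Finset α → ℝ}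
    (hf : ∀ F ⊆ E, f F = f (F ∩ E₁)) : expect p E f = expect p E₁ f := by
  have hE : E = E₁ ∪ (E \ E₁) := (Finset.union_sdiff_of_subset h).symm
  rw [hE, expect_union p Finset.disjoint_sdiff]
  refine expect_congr_fun fun F₁ h₁ => ?_
  rw [expect_congr_fun (g := fun _ => f F₁), expect_const]
  intro F₂ h₂
  rw [hf _ (Finset.union_subset (h₁.trans h) (h₂.trans Finset.sdiff_subset))]
  congr 1
  ext e
  simp only [Finset.mem_inter, Finset.mem_union]
  constructor
  · rintro ⟨h3 | h3, h4⟩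
    · exact h3
    · exact absurd h4 (Finset.mem_sdiff.1 (h₂ h3)).2
  · exact fun h3 => ⟨Or.inl h3, h₁ h3⟩

/-- Increasing observables have expectations that increase with the parameters. -/
lemma expect_mono_param {p q : α → ℝ} {E : Finset α} {f : Finset α → ℝ}
    (hp : ∀ e ∈ E, 0 ≤ p e) (hpq : ∀ e ∈ E, p e ≤ q e) (hq : ∀ e ∈ E, q e ≤ 1)
    (hf : Monotone f) : expect p E f ≤ expect q E f := by
  induction E using Finset.induction_on generalizing f with
  | empty => simp [expect_empty]
  | insert e E he ih =>
    have hm : Monotone fun F => f (insert e F) :=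
      fun _ _ h => hf (Finset.insert_subset_insert e h)
    have e1 := ih (fun a ha => hp a (Finset.mem_insert_of_mem ha))
      (fun a ha => hpq a (Finset.mem_insert_of_mem ha))
      (fun a ha => hq a (Finset.mem_insert_of_mem ha)) hf
    have e2 := ih (fun a ha => hp a (Finset.mem_insert_of_mem ha))
      (fun a ha => hpq a (Finset.mem_insert_of_mem ha))
      (fun a ha => hq a (Finset.mem_insert_of_mem ha)) hm
    have hq' : ∀ a ∈ E, 0 ≤ q a ∧ q a ≤ 1 := fun a ha =>
      ⟨(hp a (Finset.mem_insert_of_mem ha)).trans (hpq a (Finset.mem_insert_of_mem ha)),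
        hq a (Finset.mem_insert_of_mem ha)⟩
    have e3 : expect q E f ≤ expect q E (fun F => f (insert e F)) :=
      expect_le_expect hq' fun F _ => hf (Finset.subset_insert e F)
    have h1 := hp e (Finset.mem_insert_self e E)
    have h2 := hpq e (Finset.mem_insert_self e E)
    have h3 := hq e (Finset.mem_insert_self e E)
    rw [expect_insert p he, expect_insert q he]
    nlinarith

lemma expect_le_of_subset {p : α → ℝ} {E₁ E : Finset α} (h : E₁ ⊆ E) {f : Finset α → ℝ}
    (hp : ∀ e ∈ E, 0 ≤ p e ∧ p e ≤ 1) (hf : Monotone f) : expect p E₁ f ≤ expect p E f := by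
  have h1 : expect p E₁ f = expect p E (fun F => f (F ∩ E₁)) := by
    rw [expect_local p h (f := fun F => f (F ∩ E₁))]
    · exact expect_congr_fun fun F hF => by rw [Finset.inter_eq_left.2 hF]
    · intro F _
      simp [Finset.inter_assoc]
  rw [h1]
  exact expect_le_expect hp fun F _ => hf Finset.inter_subset_left

/-- The Harris inequality: increasing observables are positively correlated. -/
lemma expect_mul_le_expect_mul {p : α → ℝ} {E : Finset α} {f g : Finset α → ℝ}
    (hp : ∀ e ∈ E, 0 ≤ p e ∧ p e ≤ 1) (hf : Monotone f) (hg : Monotone g) :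
    expect p E f * expect p E g ≤ expect p E (fun F => f F * g F) := by
  induction E using Finset.induction_on generalizing f g with
  | empty => simp [expect_empty]
  | insert e E he ih =>
    have hp' : ∀ a ∈ E, 0 ≤ p a ∧ p a ≤ 1 := fun a ha => hp a (Finset.mem_insert_of_mem ha)
    have hf' : Monotone fun F => f (insert e F) :=
      fun _ _ h => hf (Finset.insert_subset_insert e h)
    have hg' : Monotone fun F => g (insert e F) :=
      fun _ _ h => hg (Finset.insert_subset_insert e h)
    have e1 := ih hp' hf hg
    have e2 := ih hp' hf' hg'
    have e3 : expect p E f ≤ expect p E (fun F => f (insert e F)) :=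
      expect_le_expect hp' fun F _ => hf (Finset.subset_insert e F)
    have e4 : expect p E g ≤ expect p E (fun F => g (insert e F)) :=
      expect_le_expect hp' fun F _ => hg (Finset.subset_insert e F)
    obtain ⟨h1, h2⟩ := hp e (Finset.mem_insert_self e E)
    rw [expect_insert p he, expect_insert p he, expect_insert p he]
    have key := mul_nonneg (mul_nonneg h1 (sub_nonneg.2 h2))
      (mul_nonneg (sub_nonneg.2 e3) (sub_nonneg.2 e4))
    nlinarith [mul_le_mul_of_nonneg_left e1 (sub_nonneg.2 h2),
      mul_le_mul_of_nonneg_left e2 h1]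

/-- Russo's formula. -/
lemma hasDerivAt_expect {p : ℝ → α → ℝ} {p' : α → ℝ} {b : ℝ} {E : Finset α}
    (hp : ∀ e ∈ E, HasDerivAt (fun t => p t e) (p' e) b) (f : Finset α → ℝ) :
    HasDerivAt (fun t => expect (p t) E f)
      (∑ e ∈ E, p' e * expect (p b) E (fun F => f (insert e F) - f (F.erase e))) b := by
  induction E using Finset.induction_on generalizing f with
  | empty => simpa [expect_empty] using hasDerivAt_const b (f ∅)
  | insert e E he ih =>
    have hp' : ∀ a ∈ E, HasDerivAt (fun t => p t a) (p' a) b :=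
      fun a ha => hp a (Finset.mem_insert_of_mem ha)
    have he' := hp e (Finset.mem_insert_self e E)
    have h := ((he'.const_sub 1).mul (ih hp' f)).add
      (he'.mul (ih hp' (fun F => f (insert e F))))
    have h1 : (fun t => expect (p t) (insert e E) f) =
        (fun t => 1 - p t e) * (fun t => expect (p t) E f) +
          (fun t => p t e) * fun t => expect (p t) E (fun F => f (insert e F)) := by
      funext t
      simp [expect_insert (p t) he]
    rw [h1]
    refine h.congr_deriv ?_
    rw [Finset.sum_insert he]
    have h2 : expect (p b) (insert e E) (fun F => f (insert e F) - f (F.erase e)) =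
        expect (p b) E (fun F => f (insert e F)) - expect (p b) E f := by
      rw [expect_insert (p b) he, ← expect_sub]
      have : ∀ F ⊆ E, F.erase e = F := fun F hF =>
        Finset.erase_eq_of_notMem fun h => he (hF h)
      rw [expect_congr_fun (g := fun F => f (insert e F) - f F) fun F hF => by
          rw [this F hF],
        expect_congr_fun (f := fun F => f (insert e (insert e F)) - f ((insert e F).erase e))
          (g := fun F => f (insert e F) - f F) fun F hF => by
            rw [Finset.insert_idem, Finset.erase_insert fun h => he (hF h)]]
      ring
    have h3 : ∑ a ∈ E, p' a * expect (p b) (insert e E) (fun F => f (insert a F) - f (F.erase a)) =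
        (1 - p b e) * (∑ a ∈ E, p' a * expect (p b) E (fun F => f (insert a F) - f (F.erase a))) +
        p b e * (∑ a ∈ E, p' a * expect (p b) E
          (fun F => f (insert e (insert a F)) - f (insert e (F.erase a)))) := by
      rw [Finset.mul_sum, Finset.mul_sum, ← Finset.sum_add_distrib]
      refine Finset.sum_congr rfl fun a ha => ?_
      have hae : e ≠ a := fun h => he (h ▸ ha)
      rw [expect_insert (p b) he]
      simp only [Finset.insert_comm a e, Finset.erase_insert_of_ne hae]
      ring
    rw [h2, h3]
    ring

end Expectation

/-! ### Clusters of finite sets of edges -/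

section Clusters

variable {V : Type*} [DecidableEq V]

/-- The graph whose edges are the non-degenerate pairs in `F`. -/
def bondGraph (F : Finset (Sym2 V)) : SimpleGraph V := SimpleGraph.fromEdgeSet (F : Set (Sym2 V))

lemma bondGraph_mono : Monotone (bondGraph : Finset (Sym2 V) → SimpleGraph V) :=
  fun _ _ h => SimpleGraph.fromEdgeSet_mono (Finset.coe_subset.2 h)

lemma reachable_mono {F F' : Finset (Sym2 V)} (h : F ⊆ F') {a b : V}
    (hab : (bondGraph F).Reachable a b) : (bondGraph F').Reachable a b :=
  hab.mono (bondGraph_mono h)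

lemma reachable_of_mem {F : Finset (Sym2 V)} {a b : V} (h : s(a, b) ∈ F) :
    (bondGraph F).Reachable a b := by
  by_cases hab : a = b
  · rw [hab]
  · exact SimpleGraph.Adj.reachable ((SimpleGraph.fromEdgeSet_adj _).2 ⟨h, hab⟩)

lemma reachable_induction {F : Finset (Sym2 V)} {a y : V} {P : V → Prop}
    (h : (bondGraph F).Reachable a y) (h0 : P a)
    (hs : ∀ b c, (bondGraph F).Reachable a b → s(b, c) ∈ F → P b → P c) : P y := by
  rw [SimpleGraph.reachable_iff_reflTransGen] at h
  induction h with
  | refl => exact h0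
  | tail h1 h2 ih =>
    exact hs _ _ ((SimpleGraph.reachable_iff_reflTransGen _ _).2 h1)
      ((SimpleGraph.fromEdgeSet_adj _).1 h2).1 ih

/-- The union of the clusters of the points of `A`, in the graph with edges `F`. -/
noncomputable def clusterOf (F : Finset (Sym2 V)) (A : Finset V) : Finset V :=
  (A ∪ F.biUnion Sym2.toFinset).filter fun y => ∃ a ∈ A, (bondGraph F).Reachable a y

lemma mem_clusterOf {F : Finset (Sym2 V)} {A : Finset V} {y : V} :
    y ∈ clusterOf F A ↔ ∃ a ∈ A, (bondGraph F).Reachable a y := by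
  simp only [clusterOf, Finset.mem_filter, and_iff_right_iff_imp]
  rintro ⟨a, ha, h⟩
  refine reachable_induction (P := fun y => y ∈ A ∪ F.biUnion Sym2.toFinset) h
    (Finset.mem_union_left _ ha) fun b c _ hbc _ => Finset.mem_union_right _ ?_
  exact Finset.mem_biUnion.2 ⟨_, hbc, Sym2.mem_toFinset.2 (Sym2.mem_mk_right b c)⟩

lemma mem_clusterOf_singleton {F : Finset (Sym2 V)} {x y : V} :
    y ∈ clusterOf F {x} ↔ (bondGraph F).Reachable x y := by
  simp [mem_clusterOf]

lemma subset_clusterOf (F : Finset (Sym2 V)) (A : Finset V) : A ⊆ clusterOf F A :=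
  fun a ha => mem_clusterOf.2 ⟨a, ha, SimpleGraph.Reachable.refl a⟩

lemma mem_clusterOf_self (F : Finset (Sym2 V)) (x : V) : x ∈ clusterOf F {x} :=
  mem_clusterOf_singleton.2 (SimpleGraph.Reachable.refl x)

lemma clusterOf_card_pos (F : Finset (Sym2 V)) (x : V) : 0 < (clusterOf F {x}).card :=
  Finset.card_pos.2 ⟨x, mem_clusterOf_self F x⟩

lemma clusterOf_mono {F F' : Finset (Sym2 V)} (h : F ⊆ F') (A : Finset V) :
    clusterOf F A ⊆ clusterOf F' A := by
  intro y hy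
  obtain ⟨a, ha, hay⟩ := mem_clusterOf.1 hy
  exact mem_clusterOf.2 ⟨a, ha, reachable_mono h hay⟩

lemma reachable_mem {F : Finset (Sym2 V)} {Λ : Finset V} (hF : F ⊆ Λ.sym2) {x y : V}
    (hx : x ∈ Λ) (h : (bondGraph F).Reachable x y) : y ∈ Λ :=
  reachable_induction (P := fun y => y ∈ Λ) h hx fun _ _ _ hbc _ =>
    (Finset.mk_mem_sym2_iff.1 (hF hbc)).2

lemma clusterOf_subset {F : Finset (Sym2 V)} {Λ A : Finset V} (hF : F ⊆ Λ.sym2) (hA : A ⊆ Λ) :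
    clusterOf F A ⊆ Λ := by
  intro y hy
  obtain ⟨a, ha, hay⟩ := mem_clusterOf.1 hy
  exact reachable_mem hF (hA ha) hay

lemma clusterOf_eq_of_reachable {F : Finset (Sym2 V)} {x y : V}
    (h : (bondGraph F).Reachable x y) : clusterOf F {x} = clusterOf F {y} := by
  ext z
  rw [mem_clusterOf_singleton, mem_clusterOf_singleton]
  exact ⟨fun h' => h.symm.trans h', fun h' => h.trans h'⟩

lemma mem_clusterOf_of_edge {F : Finset (Sym2 V)} {A : Finset V} {b c : V}
    (hb : b ∈ clusterOf F A) (h : s(b, c) ∈ F) : c ∈ clusterOf F A := by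
  obtain ⟨a, ha, hab⟩ := mem_clusterOf.1 hb
  exact mem_clusterOf.2 ⟨a, ha, hab.trans (reachable_of_mem h)⟩

/-- The pair `e` has an endpoint in `T`. -/
def Touches (T : Finset V) (e : Sym2 V) : Prop := ∃ v ∈ e, v ∈ T

lemma touches_mk {T : Finset V} {a b : V} : Touches T s(a, b) ↔ a ∈ T ∨ b ∈ T := by
  simp [Touches]

/-- Whether the cluster of `A` is `T` is determined by the edges touching `T`. -/
lemma clusterOf_eq_of_agree {F F' : Finset (Sym2 V)} {A T : Finset V}
    (h : ∀ e, Touches T e → (e ∈ F ↔ e ∈ F')) (hT : clusterOf F A = T) : clusterOf F' A = T := by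
  subst hT
  ext y
  constructor
  · intro hy
    obtain ⟨a, ha, hay⟩ := mem_clusterOf.1 hy
    refine reachable_induction (P := fun y => y ∈ clusterOf F A) hay
      (subset_clusterOf F A ha) fun b c _ hbc hb => ?_
    exact mem_clusterOf_of_edge hb ((h _ (touches_mk.2 (Or.inl hb))).2 hbc)
  · intro hy
    obtain ⟨a, ha, hay⟩ := mem_clusterOf.1 hy
    refine reachable_induction (P := fun y => y ∈ clusterOf F' A) hay
      (subset_clusterOf F' A ha) fun b c hab hbc hb => ?_
    exact mem_clusterOf_of_edge hb
      ((h _ (touches_mk.2 (Or.inl (mem_clusterOf.2 ⟨a, ha, hab⟩)))).1 hbc)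

lemma clusterOf_eq_iff_inter {F E : Finset (Sym2 V)} (hF : F ⊆ E) {A T : Finset V} :
    clusterOf F A = T ↔ clusterOf (F ∩ E.filter (Touches T)) A = T := by
  have h : ∀ e, Touches T e → (e ∈ F ↔ e ∈ F ∩ E.filter (Touches T)) := fun e he => by
    simp only [Finset.mem_inter, Finset.mem_filter, he, and_true]
    exact ⟨fun h => ⟨h, hF h⟩, fun h => h.1⟩
  exact ⟨clusterOf_eq_of_agree h, clusterOf_eq_of_agree fun e he => (h e he).symm⟩

/-- Reachability after opening one more edge. -/
lemma reachable_insert {F : Finset (Sym2 V)} {a b x y : V} :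
    (bondGraph (insert s(a, b) F)).Reachable x y ↔ (bondGraph F).Reachable x y ∨
      ((bondGraph F).Reachable x a ∧ (bondGraph F).Reachable b y) ∨
      ((bondGraph F).Reachable x b ∧ (bondGraph F).Reachable a y) := by
  constructor
  · intro h
    refine reachable_induction (P := fun y => (bondGraph F).Reachable x y ∨
      ((bondGraph F).Reachable x a ∧ (bondGraph F).Reachable b y) ∨
      ((bondGraph F).Reachable x b ∧ (bondGraph F).Reachable a y)) h
      (Or.inl (SimpleGraph.Reachable.refl x)) fun u v _ huv hu => ?_
    rcases Finset.mem_insert.1 huv with h1 | h1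
    · rcases Sym2.eq_iff.1 h1 with ⟨rfl, rfl⟩ | ⟨rfl, rfl⟩
      · rcases hu with hu | ⟨h2, _⟩ | ⟨h2, _⟩
        · exact Or.inr (Or.inl ⟨hu, SimpleGraph.Reachable.refl _⟩)
        · exact Or.inr (Or.inl ⟨h2, SimpleGraph.Reachable.refl _⟩)
        · exact Or.inl h2
      · rcases hu with hu | ⟨h2, _⟩ | ⟨h2, _⟩
        · exact Or.inr (Or.inr ⟨hu, SimpleGraph.Reachable.refl _⟩)
        · exact Or.inl h2
        · exact Or.inr (Or.inr ⟨h2, SimpleGraph.Reachable.refl _⟩)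
    · have h2 := reachable_of_mem h1
      rcases hu with hu | ⟨h3, h4⟩ | ⟨h3, h4⟩
      · exact Or.inl (hu.trans h2)
      · exact Or.inr (Or.inl ⟨h3, h4.trans h2⟩)
      · exact Or.inr (Or.inr ⟨h3, h4.trans h2⟩)
  · have hsub : F ⊆ insert s(a, b) F := Finset.subset_insert _ _
    have hab : (bondGraph (insert s(a, b) F)).Reachable a b :=
      reachable_of_mem (Finset.mem_insert_self _ _)
    rintro (h | ⟨h1, h2⟩ | ⟨h1, h2⟩)
    · exact reachable_mono hsub h
    · exact ((reachable_mono hsub h1).trans hab).trans (reachable_mono hsub h2)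
    · exact ((reachable_mono hsub h1).trans hab.symm).trans (reachable_mono hsub h2)

lemma reachable_image {W : Type*} [DecidableEq W] (τ : V → W) {F : Finset (Sym2 V)} {x y : V}
    (h : (bondGraph F).Reachable x y) :
    (bondGraph (F.image (Sym2.map τ))).Reachable (τ x) (τ y) :=
  reachable_induction (P := fun y => (bondGraph (F.image (Sym2.map τ))).Reachable (τ x) (τ y)) h
    (SimpleGraph.Reachable.refl _) fun b c _ hbc hb => hb.trans <|
      reachable_of_mem (Finset.mem_image.2 ⟨_, hbc, Sym2.map_mk τ b c⟩)

lemma reachable_image_iff (τ : V ≃ V) {F : Finset (Sym2 V)} {x y : V} :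
    (bondGraph (F.image (Sym2.map τ))).Reachable (τ x) (τ y) ↔ (bondGraph F).Reachable x y := by
  refine ⟨fun h => ?_, reachable_image τ⟩
  have := reachable_image τ.symm h
  simpa [Finset.image_image, Sym2.map_comp.symm] using this

lemma clusterOf_image (τ : V ≃ V) (F : Finset (Sym2 V)) (x : V) :
    clusterOf (F.image (Sym2.map τ)) {τ x} = (clusterOf F {x}).image τ := by
  ext y
  obtain ⟨y, rfl⟩ := τ.surjective y
  rw [mem_clusterOf_singleton, reachable_image_iff]
  simp [mem_clusterOf_singleton]

end Clusters

/-- Transport of expectations along an injection. -/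
lemma expect_image {α β : Type*} [DecidableEq α] [DecidableEq β] (p : β → ℝ) {τ : α → β}
    (hτ : Function.Injective τ) (E : Finset α) (f : Finset β → ℝ) :
    expect p (E.image τ) f = expect (p ∘ τ) E (fun F => f (F.image τ)) := by
  induction E using Finset.induction_on generalizing f with
  | empty => simp [expect_empty]
  | insert e E he ih =>
    have : τ e ∉ E.image τ := by simpa [hτ.eq_iff] using he
    rw [Finset.image_insert, expect_insert p this, expect_insert _ he, ih, ih]
    simp [Finset.image_insert]

/-! ### The two-ghost identity -/

section TwoGhost

variable {V : Type*} [DecidableEq V]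

/-- The number of vertices in the cluster of `x`. -/
noncomputable def clusterSize (F : Finset (Sym2 V)) (x : V) : ℕ := (clusterOf F {x}).card

lemma clusterSize_pos (F : Finset (Sym2 V)) (x : V) : 0 < clusterSize F x :=
  clusterOf_card_pos F x

lemma clusterSize_mono (x : V) : Monotone fun F : Finset (Sym2 V) => clusterSize F x :=
  fun _ _ h => Finset.card_le_card (clusterOf_mono h {x})

lemma clusterSize_eq_of_reachable {F : Finset (Sym2 V)} {x y : V}
    (h : (bondGraph F).Reachable x y) : clusterSize F x = clusterSize F y := by
  rw [clusterSize, clusterOf_eq_of_reachable h, clusterSize]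

/-- The centred contribution of the pair `e`: it is `J e` if `e` is closed, and `-a e` if `e` is
open. -/
noncomputable def fluctuation (J a : Sym2 V → ℝ) (F : Finset (Sym2 V)) (e : Sym2 V) : ℝ :=
  if e ∈ F then -a e else J e

/-- The sum of the centred contributions of the pairs in `E` that touch the cluster of `x`. -/
noncomputable def clusterFluctuation (J a : Sym2 V → ℝ) (E F : Finset (Sym2 V)) (x : V) : ℝ :=
  ∑ e ∈ E.filter (Touches (clusterOf F {x})), fluctuation J a F e

/-- The product `g |K| * g |K'|` over the clusters `K`, `K'` of the two endpoints of a pair if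
these are distinct, and `0` if they coincide. When `g k` is the probability that a cluster of size
`k` meets an independent random set of ghosts, this is the conditional probability that `K` and
`K'` are distinct and both meet it. -/
noncomputable def ghostPair (g : ℕ → ℝ) (F : Finset (Sym2 V)) : Sym2 V → ℝ :=
  Sym2.lift ⟨fun x y => if (bondGraph F).Reachable x y then 0 else
    g (clusterSize F x) * g (clusterSize F y), fun x y => by
      simp only [SimpleGraph.reachable_comm (u := x), mul_comm]⟩

lemma ghostPair_mk (g : ℕ → ℝ) (F : Finset (Sym2 V)) (x y : V) :
    ghostPair g F s(x, y) = if (bondGraph F).Reachable x y then 0 else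
      g (clusterSize F x) * g (clusterSize F y) := rfl

lemma ghostPair_of_mem (g : ℕ → ℝ) {F : Finset (Sym2 V)} {e : Sym2 V} (he : e ∈ F) :
    ghostPair g F e = 0 := by
  induction e with
  | h x y => rw [ghostPair_mk, if_pos (reachable_of_mem he)]

/-- The sum of `g |K|` over the clusters `K` touching `e`, written as a sum over vertices. -/
noncomputable def touchSum (g : ℕ → ℝ) (Λ : Finset V) (F : Finset (Sym2 V)) (e : Sym2 V) : ℝ :=
  ∑ x ∈ Λ.filter (fun x => Touches (clusterOf F {x}) e), g (clusterSize F x) / clusterSize F x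

lemma sum_clusterOf_div (g : ℕ → ℝ) (F : Finset (Sym2 V)) (a : V) :
    ∑ x ∈ clusterOf F {a}, g (clusterSize F x) / clusterSize F x = g (clusterSize F a) := by
  have h : ∀ x ∈ clusterOf F {a}, g (clusterSize F x) / clusterSize F x =
      g (clusterSize F a) / clusterSize F a := fun x hx => by
    rw [clusterSize_eq_of_reachable (mem_clusterOf_singleton.1 hx)]
  rw [Finset.sum_congr rfl h, Finset.sum_const, nsmul_eq_mul]
  have : (clusterSize F a : ℝ) ≠ 0 := Nat.cast_ne_zero.2 (clusterSize_pos F a).ne'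
  rw [← clusterSize]
  field_simp

lemma touchSum_mk (g : ℕ → ℝ) {Λ : Finset V} {F : Finset (Sym2 V)} (hF : F ⊆ Λ.sym2) {a b : V}
    (ha : a ∈ Λ) (hb : b ∈ Λ) :
    touchSum g Λ F s(a, b) = if (bondGraph F).Reachable a b then g (clusterSize F a) else
      g (clusterSize F a) + g (clusterSize F b) := by
  have h1 : Λ.filter (fun x => Touches (clusterOf F {x}) s(a, b)) =
      clusterOf F {a} ∪ clusterOf F {b} := by
    ext x
    simp only [Finset.mem_filter, touches_mk, Finset.mem_union, mem_clusterOf_singleton,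
      SimpleGraph.reachable_comm (u := x)]
    refine and_iff_right_of_imp ?_
    rintro (h | h)
    · exact reachable_mem hF ha h
    · exact reachable_mem hF hb h
  rw [touchSum, h1]
  split_ifs with h
  · rw [← clusterOf_eq_of_reachable h, Finset.union_self, sum_clusterOf_div]
  · rw [Finset.sum_union, sum_clusterOf_div, sum_clusterOf_div]
    refine Finset.disjoint_left.2 fun x hx hx' => h ?_
    exact (mem_clusterOf_singleton.1 hx).trans (mem_clusterOf_singleton.1 hx').symm

lemma clusterSize_insert_of_not_reachable {F : Finset (Sym2 V)} {a b : V}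
    (h : ¬(bondGraph F).Reachable a b) :
    clusterSize (insert s(a, b) F) a = clusterSize F a + clusterSize F b := by
  have h1 : clusterOf (insert s(a, b) F) {a} = clusterOf F {a} ∪ clusterOf F {b} := by
    ext x
    rw [Finset.mem_union, mem_clusterOf_singleton, mem_clusterOf_singleton,
      mem_clusterOf_singleton, reachable_insert]
    simp [h]
  rw [clusterSize, h1, Finset.card_union_of_disjoint]
  · rfl
  refine Finset.disjoint_left.2 fun x hx hx' => h ?_
  exact (mem_clusterOf_singleton.1 hx).trans (mem_clusterOf_singleton.1 hx').symm

lemma clusterSize_insert_of_reachable {F : Finset (Sym2 V)} {a b : V}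
    (h : (bondGraph F).Reachable a b) :
    clusterSize (insert s(a, b) F) a = clusterSize F a := by
  have h1 : clusterOf (insert s(a, b) F) {a} = clusterOf F {a} := by
    ext x
    rw [mem_clusterOf_singleton, mem_clusterOf_singleton, reachable_insert]
    constructor
    · rintro (h1 | ⟨_, h1⟩ | ⟨_, h1⟩)
      · exact h1
      · exact h.trans h1
      · exact h1
    · exact Or.inl
  rw [clusterSize, h1, clusterSize]

lemma touchSum_sub_touchSum_insert {g : ℕ → ℝ} (hg : ∀ m n, g m + g n - g (m + n) = g m * g n)
    {Λ : Finset V} {F : Finset (Sym2 V)} (hF : F ⊆ Λ.sym2) {e : Sym2 V} (he : e ∈ Λ.sym2) :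
    touchSum g Λ F e - touchSum g Λ (insert e F) e = ghostPair g F e := by
  induction e with
  | h a b =>
    obtain ⟨ha, hb⟩ := Finset.mk_mem_sym2_iff.1 he
    rw [touchSum_mk g hF ha hb, touchSum_mk g (Finset.insert_subset he hF) ha hb, ghostPair_mk,
      if_pos (reachable_of_mem (Finset.mem_insert_self _ F))]
    split_ifs with h
    · rw [clusterSize_insert_of_reachable h, sub_self]
    · rw [clusterSize_insert_of_not_reachable h, hg]

/-- The exact form of the two-ghost argument on a finite graph. The key point is that closing or
opening the pair `e` changes the total contribution of the clusters touching `e` only if its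
endpoints are in distinct clusters when it is closed. -/
theorem sum_mul_expect_ghostPair {p J a : Sym2 V → ℝ} {g : ℕ → ℝ} (Λ : Finset V)
    (hpa : ∀ e, p e * a e = (1 - p e) * J e)
    (hg : ∀ m n, g m + g n - g (m + n) = g m * g n) :
    ∑ e ∈ Λ.sym2, J e * expect p Λ.sym2 (fun F => ghostPair g F e) =
      ∑ x ∈ Λ, expect p Λ.sym2 (fun F => clusterFluctuation J a Λ.sym2 F x *
        (g (clusterSize F x) / clusterSize F x)) := by
  have h1 : ∀ e ∈ Λ.sym2, J e * expect p Λ.sym2 (fun F => ghostPair g F e) =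
      expect p Λ.sym2 (fun F => fluctuation J a F e * touchSum g Λ F e) := by
    intro e he
    have hsub : Λ.sym2.erase e ⊆ Λ.sym2 := Finset.erase_subset _ _
    rw [expect_erase p he, expect_erase p he]
    have e1 : expect p (Λ.sym2.erase e) (fun F => ghostPair g (insert e F) e) = 0 := by
      rw [expect_congr_fun (g := fun _ => 0), expect_const]
      exact fun F _ => ghostPair_of_mem g (Finset.mem_insert_self e F)
    have e2 : expect p (Λ.sym2.erase e) (fun F => fluctuation J a F e * touchSum g Λ F e) =
        J e * expect p (Λ.sym2.erase e) (fun F => touchSum g Λ F e) := by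
      rw [← expect_const_mul]
      refine expect_congr_fun fun F hF => ?_
      have : e ∉ F := fun h => Finset.notMem_erase e _ (hF h)
      rw [fluctuation, if_neg this]
    have e3 : expect p (Λ.sym2.erase e)
        (fun F => fluctuation J a (insert e F) e * touchSum g Λ (insert e F) e) =
        -a e * expect p (Λ.sym2.erase e) (fun F => touchSum g Λ (insert e F) e) := by
      rw [← expect_const_mul]
      refine expect_congr_fun fun F hF => ?_
      rw [fluctuation, if_pos (Finset.mem_insert_self e F)]
    have e4 : expect p (Λ.sym2.erase e) (fun F => ghostPair g F e) =
        expect p (Λ.sym2.erase e) (fun F => touchSum g Λ F e) -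
        expect p (Λ.sym2.erase e) (fun F => touchSum g Λ (insert e F) e) := by
      rw [← expect_sub]
      exact expect_congr_fun fun F hF =>
        (touchSum_sub_touchSum_insert hg (hF.trans hsub) he).symm
    rw [e1, e2, e3, e4]
    linear_combination (expect p (Λ.sym2.erase e) (fun F => touchSum g Λ (insert e F) e)) * hpa e
  rw [Finset.sum_congr rfl h1, ← expect_sum, ← expect_sum]
  refine expect_congr_fun fun F _ => ?_
  simp only [touchSum, clusterFluctuation, Finset.mul_sum, Finset.sum_mul, Finset.sum_filter]
  rw [Finset.sum_comm]
  refine Finset.sum_congr rfl fun x _ => Finset.sum_congr rfl fun e _ => ?_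
  split_ifs <;> ring

/-! ### Exponential moments of the fluctuation of a cluster -/

/-- Changing the parameters from `p` to `q` on the pairs touching the cluster of `A` only
yields a probability distribution. -/
lemma sum_prod_touches_eq_one (p q : Sym2 V → ℝ) (E : Finset (Sym2 V)) (A : Finset V) :
    ∑ F ∈ E.powerset, ∏ e ∈ E, (if Touches (clusterOf F A) e then
      (if e ∈ F then q e else 1 - q e) else (if e ∈ F then p e else 1 - p e)) = 1 := by
  let U := clusterOf E A
  have hU : ∀ F ⊆ E, clusterOf F A ∈ U.powerset := fun F hF =>
    Finset.mem_powerset.2 (clusterOf_mono hF A)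
  let mix : Finset V → Sym2 V → ℝ := fun T e => if Touches T e then q e else p e
  have h1 : ∀ T, expect (mix T) E (fun F => if clusterOf F A = T then 1 else 0) =
      expect q E (fun F => if clusterOf F A = T then 1 else 0) := by
    intro T
    have hl : ∀ F ⊆ E, (if clusterOf F A = T then (1 : ℝ) else 0) =
        if clusterOf (F ∩ E.filter (Touches T)) A = T then 1 else 0 := fun F hF => by
      simp only [clusterOf_eq_iff_inter hF]
    rw [expect_local _ (Finset.filter_subset (Touches T) E) hl,
      expect_local _ (Finset.filter_subset (Touches T) E) hl]
    refine expect_congr (fun e he => ?_) fun _ _ => rfl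
    simp [mix, (Finset.mem_filter.1 he).2]
  have h2 : ∀ F ∈ E.powerset, ∏ e ∈ E, (if Touches (clusterOf F A) e then
      (if e ∈ F then q e else 1 - q e) else (if e ∈ F then p e else 1 - p e)) =
      ∑ T ∈ U.powerset, bernoulliWeight (mix T) E F * (if clusterOf F A = T then 1 else 0) := by
    intro F hF
    simp only [mul_ite, mul_one, mul_zero]
    rw [Finset.sum_ite_eq, if_pos (hU F (Finset.mem_powerset.1 hF)), bernoulliWeight]
    refine Finset.prod_congr rfl fun e _ => ?_
    simp only [mix]
    split_ifs <;> rfl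
  rw [Finset.sum_congr rfl h2, Finset.sum_comm]
  change ∑ T ∈ U.powerset, expect (mix T) E (fun F => if clusterOf F A = T then 1 else 0) = 1
  rw [Finset.sum_congr rfl fun T _ => h1 T, ← expect_sum,
    expect_congr_fun (g := fun _ => 1), expect_const]
  intro F hF
  rw [Finset.sum_ite_eq, if_pos (hU F hF)]

lemma sum_touches_le {J : Sym2 V → ℝ} (hJ : ∀ e, 0 ≤ J e) {Λ T : Finset V} {B : ℝ}
    (hT : T ⊆ Λ) (hsum : ∀ x ∈ Λ, ∑ y ∈ Λ, J s(x, y) ≤ B) :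
    ∑ e ∈ Λ.sym2.filter (Touches T), J e ≤ T.card * B := by
  have h1 : Λ.sym2.filter (Touches T) ⊆ (T ×ˢ Λ).image (fun z => s(z.1, z.2)) := by
    intro e he
    induction e with
    | h a b =>
      obtain ⟨h1, h2⟩ := Finset.mem_filter.1 he
      obtain ⟨ha, hb⟩ := Finset.mk_mem_sym2_iff.1 h1
      rcases touches_mk.1 h2 with h | h
      · exact Finset.mem_image.2 ⟨(a, b), Finset.mk_mem_product h hb, rfl⟩
      · exact Finset.mem_image.2 ⟨(b, a), Finset.mk_mem_product h ha, Sym2.eq_swap⟩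
  calc ∑ e ∈ Λ.sym2.filter (Touches T), J e
      ≤ ∑ e ∈ (T ×ˢ Λ).image (fun z => s(z.1, z.2)), J e :=
        Finset.sum_le_sum_of_subset_of_nonneg h1 fun e _ _ => hJ e
    _ ≤ ∑ z ∈ T ×ˢ Λ, J s(z.1, z.2) := Finset.sum_image_le_of_nonneg fun e _ => hJ e
    _ = ∑ x ∈ T, ∑ y ∈ Λ, J s(x, y) := Finset.sum_product _ _ _
    _ ≤ ∑ x ∈ T, B := Finset.sum_le_sum fun x hx => hsum x (hT hx)
    _ = T.card * B := by rw [Finset.sum_const, nsmul_eq_mul]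

/-- The moment generating function of the centred contribution of a single pair. -/
lemma singlePair_mgf_le {p J a B σ : ℝ} (hp : 0 ≤ p) (hp1 : p ≤ 1) (hJ : 0 ≤ J) (ha : 0 ≤ a)
    (hpa : p * a = (1 - p) * J) (hB : J + a ≤ B) (hσ : |σ| * B ≤ 1) :
    p * Real.exp (-(σ * a)) + (1 - p) * Real.exp (σ * J) ≤ Real.exp (σ ^ 2 * B * J) := by
  have hb : ∀ t : ℝ, |t| ≤ 1 → Real.exp t ≤ 1 + t + t ^ 2 := fun t ht => by
    have := abs_le.1 (Real.abs_exp_sub_one_sub_id_le ht)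
    linarith [this.2]
  have h1 : |-(σ * a)| ≤ 1 := by
    rw [abs_neg, abs_mul, abs_of_nonneg ha]
    exact (mul_le_mul_of_nonneg_left (by linarith) (abs_nonneg σ)).trans hσ
  have h2 : |σ * J| ≤ 1 := by
    rw [abs_mul, abs_of_nonneg hJ]
    exact (mul_le_mul_of_nonneg_left (by linarith) (abs_nonneg σ)).trans hσ
  have h3 := mul_le_mul_of_nonneg_left (hb _ h1) hp
  have h4 := mul_le_mul_of_nonneg_left (hb _ h2) (sub_nonneg.2 hp1)
  have h5 := Real.add_one_le_exp (σ ^ 2 * B * J)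
  have h6 : p * a ^ 2 + (1 - p) * J ^ 2 ≤ B * J := by
    have : p * a ^ 2 + (1 - p) * J ^ 2 = (1 - p) * (J * (J + a)) := by
      linear_combination a * hpa
    rw [this]
    calc (1 - p) * (J * (J + a)) ≤ 1 * (J * (J + a)) :=
          mul_le_mul_of_nonneg_right (by linarith) (by positivity)
      _ ≤ B * J := by nlinarith
  have h7 := mul_le_mul_of_nonneg_left h6 (sq_nonneg σ)
  have h8 : σ * (p * a) = σ * ((1 - p) * J) := by rw [hpa]
  nlinarith

/-- The fluctuation of a cluster is sub-Gaussian on the scale of its volume. -/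
theorem expect_exp_clusterFluctuation_le {p J a : Sym2 V → ℝ} {B σ : ℝ} {Λ : Finset V}
    (hp : ∀ e, 0 ≤ p e ∧ p e ≤ 1) (hp1 : ∀ e, p e < 1) (hJ : ∀ e, 0 ≤ J e) (ha : ∀ e, 0 ≤ a e)
    (hpa : ∀ e, p e * a e = (1 - p e) * J e) (hB : ∀ e, J e + a e ≤ B)
    (hsum : ∀ x ∈ Λ, ∑ y ∈ Λ, J s(x, y) ≤ B) (hσ : |σ| * B ≤ 1) {x : V} (hx : x ∈ Λ) :
    expect p Λ.sym2 (fun F => Real.exp (σ * clusterFluctuation J a Λ.sym2 F x -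
      σ ^ 2 * B ^ 2 * clusterSize F x)) ≤ 1 := by
  -- The tilted parameter `q` is proportional to `p` times the exponential of `σ` times the
  -- contribution of an open pair.
  let M : Sym2 V → ℝ := fun e => p e * Real.exp (-(σ * a e)) + (1 - p e) * Real.exp (σ * J e)
  have hM : ∀ e, 0 < M e := fun e => by
    have := mul_pos (sub_pos.2 (hp1 e)) (Real.exp_pos (σ * J e))
    have := mul_nonneg (hp e).1 (Real.exp_pos (-(σ * a e))).le
    simp only [M]
    linarith
  let q : Sym2 V → ℝ := fun e => p e * Real.exp (-(σ * a e)) / M e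
  have hq1 : ∀ e, 1 - q e = (1 - p e) * Real.exp (σ * J e) / M e := fun e => by
    have := (hM e).ne'
    simp only [q]
    rw [eq_div_iff this, sub_mul, div_mul_cancel₀ _ this]
    simp only [M]
    ring
  have hB0 : 0 ≤ B := by
    have h := hB s(x, x)
    linarith [hJ s(x, x), ha s(x, x)]
  rw [← sum_prod_touches_eq_one p q Λ.sym2 {x}]
  refine Finset.sum_le_sum fun F hF => ?_
  have hFE := Finset.mem_powerset.1 hF
  set T := clusterOf F {x} with hT
  have hTΛ : T ⊆ Λ := clusterOf_subset hFE (by simpa using hx)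
  have h1 : (∏ e ∈ Λ.sym2, (if Touches T e then
      (if e ∈ F then q e else 1 - q e) else (if e ∈ F then p e else 1 - p e))) =
      bernoulliWeight p Λ.sym2 F * ((∏ e ∈ Λ.sym2.filter (Touches T),
        Real.exp (σ * fluctuation J a F e)) / ∏ e ∈ Λ.sym2.filter (Touches T), M e) := by
    rw [← Finset.prod_div_distrib, Finset.prod_filter, bernoulliWeight, ← Finset.prod_mul_distrib]
    refine Finset.prod_congr rfl fun e _ => ?_
    by_cases h1 : Touches T e <;> by_cases h2 : e ∈ F <;>
      simp only [h1, h2, if_true, if_false, fluctuation, hq1, mul_neg, mul_one]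
    · exact mul_div_assoc _ _ _
    · exact mul_div_assoc _ _ _
  have h2 : ∏ e ∈ Λ.sym2.filter (Touches T), M e ≤ Real.exp (σ ^ 2 * B ^ 2 * clusterSize F x) := by
    calc ∏ e ∈ Λ.sym2.filter (Touches T), M e
        ≤ ∏ e ∈ Λ.sym2.filter (Touches T), Real.exp (σ ^ 2 * B * J e) :=
          Finset.prod_le_prod (fun e _ => (hM e).le) fun e _ =>
            singlePair_mgf_le (hp e).1 (hp e).2 (hJ e) (ha e) (hpa e) (hB e) hσ
      _ = Real.exp (σ ^ 2 * B * ∑ e ∈ Λ.sym2.filter (Touches T), J e) := by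
          rw [← Real.exp_sum, Finset.mul_sum]
      _ ≤ _ := by
          refine Real.exp_le_exp.2 ?_
          have := mul_le_mul_of_nonneg_left (sum_touches_le hJ hTΛ hsum)
            (mul_nonneg (sq_nonneg σ) hB0)
          have h3 : (T.card : ℝ) = clusterSize F x := rfl
          rw [h3] at this
          linarith
  rw [h1]
  refine mul_le_mul_of_nonneg_left ?_ (bernoulliWeight_nonneg (fun e _ => hp e) F)
  change Real.exp _ ≤ _
  rw [Real.exp_sub, ← Real.exp_sum, ← Finset.mul_sum]
  exact div_le_div_of_nonneg_left (Real.exp_pos _).le (Finset.prod_pos fun e _ => hM e) h2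

end TwoGhost

/-! ### The two-ghost inequality -/

section TwoGhostInequality

variable {V : Type*} [DecidableEq V]

lemma sum_scales_le_of_le {j L : ℕ} (h : L ≤ j) :
    ∑ k ∈ Finset.range L, (2 : ℝ) ^ k * min ((1 / 4) ^ j) ((1 / 4) ^ k) ≤ (1 / 4) ^ j * 2 ^ L := by
  induction L with
  | zero => simp
  | succ L ih =>
    rw [Finset.sum_range_succ, pow_succ]
    have h1 := ih (by omega)
    have h2 : (2 : ℝ) ^ L * min ((1 / 4) ^ j) ((1 / 4) ^ L) ≤ 2 ^ L * (1 / 4) ^ j :=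
      mul_le_mul_of_nonneg_left (min_le_left _ _) (by positivity)
    linarith

lemma sum_scales_le_of_ge {j L : ℕ} (h : j ≤ L) :
    ∑ k ∈ Finset.range L, (2 : ℝ) ^ k * min ((1 / 4) ^ j) ((1 / 4) ^ k) ≤
      3 * (1 / 2) ^ j - 2 * (1 / 2) ^ L := by
  induction L, h using Nat.le_induction with
  | base =>
    refine (sum_scales_le_of_le le_rfl).trans (le_of_eq ?_)
    rw [← mul_pow]
    norm_num
    ring
  | succ L hL ih =>
    rw [Finset.sum_range_succ, pow_succ]
    have h2 : (2 : ℝ) ^ L * min ((1 / 4) ^ j) ((1 / 4) ^ L) ≤ 2 ^ L * (1 / 4) ^ L :=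
      mul_le_mul_of_nonneg_left (min_le_right _ _) (by positivity)
    rw [← mul_pow] at h2
    norm_num at h2 ih ⊢
    linarith

lemma sum_scales_le (j L : ℕ) :
    ∑ k ∈ Finset.range L, (2 : ℝ) ^ k * min ((1 / 4) ^ j) ((1 / 4) ^ k) ≤ 3 * (1 / 2) ^ j := by
  have h1 : (∑ k ∈ Finset.range L, (2 : ℝ) ^ k * min ((1 / 4) ^ j) ((1 / 4) ^ k)) ≤
      ∑ k ∈ Finset.range (max j L), (2 : ℝ) ^ k * min ((1 / 4) ^ j) ((1 / 4) ^ k) :=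
    Finset.sum_le_sum_of_subset_of_nonneg (Finset.range_mono (le_max_right _ _))
      fun k _ _ => by positivity
  have h2 := sum_scales_le_of_ge (le_max_left j L)
  have h3 : (0 : ℝ) ≤ 2 * (1 / 2) ^ max j L := by positivity
  linarith

/-- The probability that a set of `m` points meets a random set of intensity `4⁻ʲ`. -/
noncomputable def ghostProb (j m : ℕ) : ℝ := 1 - Real.exp (-((1 / 4) ^ j * m))

lemma ghostProb_add (j m n : ℕ) :
    ghostProb j m + ghostProb j n - ghostProb j (m + n) = ghostProb j m * ghostProb j n := by
  have : Real.exp (-((1 / 4) ^ j * ((m + n : ℕ) : ℝ))) =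
      Real.exp (-((1 / 4) ^ j * m)) * Real.exp (-((1 / 4) ^ j * n)) := by
    rw [← Real.exp_add]
    congr 1
    push_cast
    ring
  simp only [ghostProb, this]
  ring

lemma ghostProb_nonneg (j m : ℕ) : 0 ≤ ghostProb j m := by
  have : Real.exp (-((1 / 4) ^ j * (m : ℝ))) ≤ 1 := Real.exp_le_one_iff.2 (by
    have : (0 : ℝ) ≤ (1 / 4) ^ j * m := by positivity
    linarith)
  unfold ghostProb
  linarith

lemma half_le_ghostProb {j m : ℕ} (h : 4 ^ j ≤ m) : 1 / 2 ≤ ghostProb j m := by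
  have h1 : (1 : ℝ) ≤ (1 / 4) ^ j * m := by
    have : ((4 : ℝ) ^ j) ≤ m := by exact_mod_cast h
    calc (1 : ℝ) = (1 / 4) ^ j * 4 ^ j := by rw [← mul_pow]; norm_num
      _ ≤ _ := mul_le_mul_of_nonneg_left this (by positivity)
  have h2 : Real.exp (-((1 / 4) ^ j * (m : ℝ))) ≤ 1 / 2 := by
    have h3 : 2 ≤ Real.exp ((1 / 4) ^ j * (m : ℝ)) := by
      have := Real.add_one_le_exp ((1 / 4) ^ j * (m : ℝ))
      linarith
    rw [Real.exp_neg]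
    exact (inv_anti₀ two_pos h3).trans (by norm_num)
  unfold ghostProb
  linarith

lemma ghostProb_div_le {j k m : ℕ} (hk : 4 ^ k ≤ m) :
    ghostProb j m / m ≤ min ((1 / 4) ^ j) ((1 / 4) ^ k) := by
  have hk' : ((4 : ℝ) ^ k) ≤ m := by exact_mod_cast hk
  have hm : (0 : ℝ) < m := lt_of_lt_of_le (by positivity) hk'
  refine le_min ?_ ?_
  · rw [div_le_iff₀ hm]
    have := Real.add_one_le_exp (-((1 / 4) ^ j * (m : ℝ)))
    unfold ghostProb
    linarith
  · rw [div_le_iff₀ hm]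
    have h1 : ghostProb j m ≤ 1 := by
      have := Real.exp_pos (-((1 / 4) ^ j * (m : ℝ)))
      unfold ghostProb
      linarith
    refine h1.trans ?_
    calc (1 : ℝ) = (1 / 4) ^ k * 4 ^ k := by rw [← mul_pow]; norm_num
      _ ≤ _ := mul_le_mul_of_nonneg_left hk' (by positivity)

/-- At the scale `4 ^ k ≤ m < 4 ^ (k + 1)`, the tilt `σ = 2⁻ᵏ / B` costs only a constant factor. -/
lemma mul_ghostProb_div_le {j k m : ℕ} {B X : ℝ} (hB : 0 < B) (hk : 4 ^ k ≤ m)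
    (hk' : m < 4 ^ (k + 1)) :
    X * (ghostProb j m / m) ≤ Real.exp 4 * B * (2 ^ k * min ((1 / 4) ^ j) ((1 / 4) ^ k)) *
      (Real.exp ((1 / 2) ^ k / B * X - ((1 / 2) ^ k / B) ^ 2 * B ^ 2 * m) +
        Real.exp (-((1 / 2) ^ k / B) * X - (-((1 / 2) ^ k / B)) ^ 2 * B ^ 2 * m)) := by
  set σ := (1 / 2 : ℝ) ^ k / B with hσ
  have hσ0 : 0 < σ := by positivity
  have h1 : σ ^ 2 * B ^ 2 * m ≤ 4 := by
    have e1 : σ ^ 2 * B ^ 2 = (1 / 4) ^ k := by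
      rw [hσ, div_pow, div_mul_cancel₀ _ (by positivity), ← pow_mul, mul_comm k 2, pow_mul]
      norm_num
    rw [e1]
    have : (m : ℝ) ≤ 4 ^ (k + 1) := by exact_mod_cast hk'.le
    calc (1 / 4 : ℝ) ^ k * m ≤ (1 / 4) ^ k * 4 ^ (k + 1) :=
          mul_le_mul_of_nonneg_left this (by positivity)
      _ = 4 := by rw [pow_succ, ← mul_assoc, ← mul_pow]; norm_num
  have h2 : 0 ≤ ghostProb j m / m := div_nonneg (ghostProb_nonneg j m) (Nat.cast_nonneg m)
  have h3 := ghostProb_div_le (j := j) hk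
  have h4 : |X| ≤ B * 2 ^ k * (Real.exp (σ * X) + Real.exp (-(σ * X))) := by
    have e1 : |X| = B * 2 ^ k * (σ * |X|) := by
      have : B * 2 ^ k * σ = 1 := by
        rw [hσ, mul_div_assoc', div_eq_one_iff_eq hB.ne', mul_assoc, ← mul_pow]
        norm_num
      rw [← mul_assoc, this, one_mul]
    rw [e1]
    refine mul_le_mul_of_nonneg_left ?_ (by positivity)
    have e2 := Real.add_one_le_exp (σ * X)
    have e3 := Real.add_one_le_exp (-(σ * X))
    have e4 := Real.exp_pos (σ * X)
    have e5 := Real.exp_pos (-(σ * X))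
    rcases abs_cases X with ⟨h, _⟩ | ⟨h, _⟩ <;> rw [h] <;> linarith
  have h5 : 1 ≤ Real.exp 4 * Real.exp (-(σ ^ 2 * B ^ 2 * m)) := by
    rw [← Real.exp_add]
    exact Real.one_le_exp (by linarith)
  have h6 : Real.exp (σ * X - σ ^ 2 * B ^ 2 * m) + Real.exp (-σ * X - (-σ) ^ 2 * B ^ 2 * m) =
      (Real.exp (σ * X) + Real.exp (-(σ * X))) * Real.exp (-(σ ^ 2 * B ^ 2 * m)) := by
    rw [add_mul, ← Real.exp_add, ← Real.exp_add]
    ring_nf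
  rw [h6]
  set c := min ((1 / 4 : ℝ) ^ j) ((1 / 4) ^ k)
  have hc : 0 ≤ c := by positivity
  calc X * (ghostProb j m / m) ≤ |X| * (ghostProb j m / m) :=
        mul_le_mul_of_nonneg_right (le_abs_self X) h2
    _ ≤ |X| * c := mul_le_mul_of_nonneg_left h3 (abs_nonneg X)
    _ ≤ (B * 2 ^ k * (Real.exp (σ * X) + Real.exp (-(σ * X)))) * c :=
        mul_le_mul_of_nonneg_right h4 hc
    _ ≤ (B * 2 ^ k * (Real.exp (σ * X) + Real.exp (-(σ * X)))) * c *
        (Real.exp 4 * Real.exp (-(σ ^ 2 * B ^ 2 * m))) :=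
        le_mul_of_one_le_right (by positivity) h5
    _ = _ := by ring

lemma expect_clusterFluctuation_mul_le {p J a : Sym2 V → ℝ} {B : ℝ} {Λ : Finset V}
    (hp : ∀ e, 0 ≤ p e ∧ p e ≤ 1) (hp1 : ∀ e, p e < 1) (hJ : ∀ e, 0 ≤ J e) (ha : ∀ e, 0 ≤ a e)
    (hpa : ∀ e, p e * a e = (1 - p e) * J e) (hB : ∀ e, J e + a e ≤ B)
    (hsum : ∀ x ∈ Λ, ∑ y ∈ Λ, J s(x, y) ≤ B) (hB0 : 0 < B) (j : ℕ) {x : V} (hx : x ∈ Λ) :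
    expect p Λ.sym2 (fun F => clusterFluctuation J a Λ.sym2 F x *
      (ghostProb j (clusterSize F x) / clusterSize F x)) ≤ 6 * Real.exp 4 * B * (1 / 2) ^ j := by
  let σ : ℕ → ℝ := fun k => (1 / 2) ^ k / B
  let c : ℕ → ℝ := fun k => 2 ^ k * min ((1 / 4) ^ j) ((1 / 4) ^ k)
  let Y : ℝ → Finset (Sym2 V) → ℝ := fun s F =>
    Real.exp (s * clusterFluctuation J a Λ.sym2 F x - s ^ 2 * B ^ 2 * clusterSize F x)
  have hc : ∀ k, 0 ≤ c k := fun k => by positivity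
  have h1 : ∀ F ⊆ Λ.sym2, clusterFluctuation J a Λ.sym2 F x *
      (ghostProb j (clusterSize F x) / clusterSize F x) ≤
      ∑ k ∈ Finset.range (Λ.card + 1), Real.exp 4 * B * c k * (Y (σ k) F + Y (-σ k) F) := by
    intro F hF
    have hm : clusterSize F x ≠ 0 := (clusterSize_pos F x).ne'
    have hmΛ : clusterSize F x ≤ Λ.card :=
      Finset.card_le_card (clusterOf_subset hF (by simpa using hx))
    have hk : Nat.log 4 (clusterSize F x) ∈ Finset.range (Λ.card + 1) :=
      Finset.mem_range.2 (Nat.lt_succ_of_le ((Nat.log_le_self 4 _).trans hmΛ))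
    refine (mul_ghostProb_div_le hB0 (Nat.pow_log_le_self 4 hm)
      (Nat.lt_pow_succ_log_self (by norm_num) _)).trans ?_
    exact Finset.single_le_sum (f := fun k => Real.exp 4 * B * c k * (Y (σ k) F + Y (-σ k) F))
      (fun k _ => by have := hc k; positivity) hk
  have hY : ∀ s : ℝ, |s| * B ≤ 1 → expect p Λ.sym2 (Y s) ≤ 1 := fun s hs =>
    expect_exp_clusterFluctuation_le hp hp1 hJ ha hpa hB hsum hs hx
  have hσ : ∀ k, |σ k| * B ≤ 1 := fun k => by
    rw [abs_of_nonneg (by positivity), div_mul_cancel₀ _ hB0.ne']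
    exact pow_le_one₀ (by norm_num) (by norm_num)
  refine (expect_le_expect (fun e _ => hp e) h1).trans ?_
  rw [expect_sum]
  calc ∑ k ∈ Finset.range (Λ.card + 1),
        expect p Λ.sym2 (fun F => Real.exp 4 * B * c k * (Y (σ k) F + Y (-σ k) F))
      ≤ ∑ k ∈ Finset.range (Λ.card + 1), Real.exp 4 * B * c k * 2 := by
        refine Finset.sum_le_sum fun k _ => ?_
        rw [expect_const_mul, expect_add]
        have e1 := hY (σ k) (hσ k)
        have e2 := hY (-σ k) (by rw [abs_neg]; exact hσ k)
        have := hc k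
        exact mul_le_mul_of_nonneg_left (by linarith) (by positivity)
    _ = 2 * Real.exp 4 * B * ∑ k ∈ Finset.range (Λ.card + 1), c k := by
        rw [Finset.mul_sum]
        exact Finset.sum_congr rfl fun k _ => by ring
    _ ≤ 2 * Real.exp 4 * B * (3 * (1 / 2) ^ j) :=
        mul_le_mul_of_nonneg_left (sum_scales_le j _) (by positivity)
    _ = _ := by ring

/-- The indicator of `n ≤ m`. With this choice of `g`, `ghostPair g` is the indicator that the
endpoints of a pair are in distinct clusters, both of size at least `n`. -/
noncomputable def atLeast (n m : ℕ) : ℝ := if n ≤ m then 1 else 0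

lemma atLeast_nonneg (n m : ℕ) : 0 ≤ atLeast n m := by unfold atLeast; split_ifs <;> norm_num

lemma atLeast_le_one (n m : ℕ) : atLeast n m ≤ 1 := by unfold atLeast; split_ifs <;> norm_num

lemma atLeast_mono (n : ℕ) : Monotone (atLeast n) := fun a b h => by
  by_cases ha : n ≤ a
  · simp [atLeast, ha, ha.trans h]
  · simpa [atLeast, ha] using atLeast_nonneg n b

/-- The two-ghost inequality on a finite graph. -/
theorem sum_mul_expect_ghostPair_atLeast_le {p J a : Sym2 V → ℝ} {B : ℝ} {Λ : Finset V}
    (hp : ∀ e, 0 ≤ p e ∧ p e ≤ 1) (hp1 : ∀ e, p e < 1) (hJ : ∀ e, 0 ≤ J e) (ha : ∀ e, 0 ≤ a e)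
    (hpa : ∀ e, p e * a e = (1 - p e) * J e) (hB : ∀ e, J e + a e ≤ B)
    (hsum : ∀ x ∈ Λ, ∑ y ∈ Λ, J s(x, y) ≤ B) (hB0 : 0 < B) {n : ℕ} (hn : 1 ≤ n) :
    ∑ e ∈ Λ.sym2, J e * expect p Λ.sym2 (fun F => ghostPair (atLeast n) F e) ≤
      48 * Real.exp 4 * B * Λ.card / Real.sqrt n := by
  -- Ghost intensity `4⁻ʲ ≍ 1 / n`, so that clusters of size `n` meet the ghosts with probability
  -- bounded below.
  set j := Nat.log 4 n with hj
  have hj1 : 4 ^ j ≤ n := Nat.pow_log_le_self 4 (by omega)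
  have hj2 : n < 4 ^ (j + 1) := Nat.lt_pow_succ_log_self (by norm_num) n
  have h1 : ∀ (F : Finset (Sym2 V)) (e : Sym2 V), ghostPair (atLeast n) F e ≤ 4 * ghostPair (ghostProb j) F e := by
    intro F e
    induction e with
    | h x y =>
      rw [ghostPair_mk, ghostPair_mk]
      split_ifs
      · simp
      · have h : ∀ m, atLeast n m ≤ 2 * ghostProb j m := fun m => by
          unfold atLeast
          split_ifs with hm
          · linarith [half_le_ghostProb (hj1.trans hm)]
          · linarith [ghostProb_nonneg j m]
        calc atLeast n (clusterSize F x) * atLeast n (clusterSize F y)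
            ≤ (2 * ghostProb j (clusterSize F x)) * (2 * ghostProb j (clusterSize F y)) :=
              mul_le_mul (h _) (h _) (atLeast_nonneg _ _)
                (mul_nonneg (by norm_num) (ghostProb_nonneg _ _))
          _ = _ := by ring
  have h2 : (1 / 2 : ℝ) ^ j ≤ 2 / Real.sqrt n := by
    have e1 : Real.sqrt n ≤ 2 ^ (j + 1) := by
      rw [show (2 : ℝ) ^ (j + 1) = Real.sqrt (4 ^ (j + 1)) by
        rw [show (4 : ℝ) = 2 ^ 2 by norm_num, ← pow_mul, mul_comm, pow_mul,
          Real.sqrt_sq (by positivity)]]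
      exact Real.sqrt_le_sqrt (by exact_mod_cast hj2.le)
    have e2 : 0 < Real.sqrt n := Real.sqrt_pos.2 (by exact_mod_cast hn)
    rw [le_div_iff₀ e2]
    calc (1 / 2 : ℝ) ^ j * Real.sqrt n ≤ (1 / 2) ^ j * 2 ^ (j + 1) :=
          mul_le_mul_of_nonneg_left e1 (by positivity)
      _ = 2 := by rw [pow_succ, ← mul_assoc, ← mul_pow]; norm_num
  calc ∑ e ∈ Λ.sym2, J e * expect p Λ.sym2 (fun F => ghostPair (atLeast n) F e)
      ≤ ∑ e ∈ Λ.sym2, 4 * (J e * expect p Λ.sym2 (fun F => ghostPair (ghostProb j) F e)) := by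
        refine Finset.sum_le_sum fun e _ => ?_
        rw [mul_left_comm, ← expect_const_mul p _ 4]
        exact mul_le_mul_of_nonneg_left (expect_le_expect (fun e _ => hp e) fun F _ => h1 F e) (hJ e)
    _ = 4 * ∑ x ∈ Λ, expect p Λ.sym2 (fun F => clusterFluctuation J a Λ.sym2 F x *
        (ghostProb j (clusterSize F x) / clusterSize F x)) := by
        rw [← Finset.mul_sum, sum_mul_expect_ghostPair Λ hpa (ghostProb_add j)]
    _ ≤ 4 * ∑ x ∈ Λ, 6 * Real.exp 4 * B * (2 / Real.sqrt n) := by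
        refine mul_le_mul_of_nonneg_left (Finset.sum_le_sum fun x hx => ?_) (by norm_num)
        refine (expect_clusterFluctuation_mul_le hp hp1 hJ ha hpa hB hsum hB0 j hx).trans ?_
        exact mul_le_mul_of_nonneg_left h2 (by positivity)
    _ = _ := by
        rw [Finset.sum_const, nsmul_eq_mul]
        ring

/-! ### Percolation with parameter `β` -/

/-- The probability `1 - exp (-β J e)` that the pair `e` is open. -/
noncomputable def bondProb (J : Sym2 V → ℝ) (β : ℝ) (e : Sym2 V) : ℝ := 1 - Real.exp (-(β * J e))

lemma bondProb_lt_one (J : Sym2 V → ℝ) (β : ℝ) (e : Sym2 V) : bondProb J β e < 1 := by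
  have := Real.exp_pos (-(β * J e))
  unfold bondProb
  linarith

lemma bondProb_mem {J : Sym2 V → ℝ} (hJ : ∀ e, 0 ≤ J e) {β : ℝ} (hβ : 0 ≤ β) (e : Sym2 V) :
    0 ≤ bondProb J β e ∧ bondProb J β e ≤ 1 := by
  refine ⟨?_, (bondProb_lt_one J β e).le⟩
  have : Real.exp (-(β * J e)) ≤ 1 := Real.exp_le_one_iff.2 (by have := mul_nonneg hβ (hJ e); linarith)
  unfold bondProb
  linarith

lemma bondProb_mono {J : Sym2 V → ℝ} (hJ : ∀ e, 0 ≤ J e) {β β' : ℝ} (h : β ≤ β') (e : Sym2 V) :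
    bondProb J β e ≤ bondProb J β' e := by
  have := Real.exp_le_exp.2 (neg_le_neg (mul_le_mul_of_nonneg_right h (hJ e)))
  unfold bondProb
  linarith

lemma bondProb_le {J : Sym2 V → ℝ} (β : ℝ) (e : Sym2 V) : bondProb J β e ≤ β * J e := by
  have := Real.add_one_le_exp (-(β * J e))
  unfold bondProb
  linarith

theorem twoGhost_inequality {J : Sym2 V → ℝ} (hJ : ∀ e, 0 ≤ J e) {D β : ℝ} (hβ : 0 < β)
    (hD : ∀ (Λ : Finset V) (x : V), ∑ y ∈ Λ, J s(x, y) ≤ D) {n : ℕ} (hn : 1 ≤ n) (Λ : Finset V) :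
    ∑ e ∈ Λ.sym2, J e * expect (bondProb J β) Λ.sym2 (fun F => ghostPair (atLeast n) F e) ≤
      48 * Real.exp 4 * (D + 1 / β) * Λ.card / Real.sqrt n := by
  by_cases hV : Λ.Nonempty
  swap
  · rw [Finset.not_nonempty_iff_eq_empty] at hV
    simp [hV]
  obtain ⟨x₀, _⟩ := hV
  have hD0 : 0 ≤ D := by simpa using hD ∅ x₀
  let a : Sym2 V → ℝ := fun e => J e / (Real.exp (β * J e) - 1)
  have hpos : ∀ e, 0 ≤ Real.exp (β * J e) - 1 := fun e => by
    have := Real.one_le_exp (mul_nonneg hβ.le (hJ e))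
    linarith
  refine sum_mul_expect_ghostPair_atLeast_le (a := a) (bondProb_mem hJ hβ.le)
    (bondProb_lt_one J β) hJ (fun e => div_nonneg (hJ e) (hpos e)) (fun e => ?_) (fun e => ?_)
    (fun x _ => (hD Λ x).trans (by have : 0 < 1 / β := by positivity
                                   linarith)) (by positivity) hn
  · rcases (hJ e).eq_or_lt with h | h
    · simp [a, bondProb, ← h]
    · have h1 : 0 < Real.exp (β * J e) - 1 := by
        have := Real.add_one_lt_exp (mul_pos hβ h).ne'
        have := mul_pos hβ h
        linarith
      have h2 : Real.exp (-(β * J e)) * Real.exp (β * J e) = 1 := by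
        rw [← Real.exp_add]; simp
      simp only [a, bondProb]
      rw [mul_div_assoc', div_eq_iff h1.ne']
      linear_combination (-J e) * h2
  · have h1 : J e ≤ D := by
      induction e with
      | h x y => simpa using hD {y} x
    refine add_le_add h1 ?_
    have h2 := Real.add_one_le_exp (β * J e)
    rcases (hpos e).eq_or_lt with h | h
    · simp only [a]
      rw [← h, div_zero]
      positivity
    · rw [div_le_div_iff₀ h hβ]
      linarith

end TwoGhostInequality

/-! ### Sharpness of the phase transition -/

/-- Observables of disjoint sets of edges are independent. -/
lemma expect_mul_of_disjoint {α : Type*} [DecidableEq α] (p : α → ℝ) {E₁ E₂ E : Finset α}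
    (h : Disjoint E₁ E₂) (h₁ : E₁ ⊆ E) (h₂ : E₂ ⊆ E) (f g : Finset α → ℝ) :
    expect p E (fun F => f (F ∩ E₁) * g (F ∩ E₂)) = expect p E₁ f * expect p E₂ g := by
  rw [expect_local p (Finset.union_subset h₁ h₂), expect_union p h, ← expect_mul_const]
  · refine expect_congr_fun fun F₁ hF₁ => ?_
    rw [← expect_const_mul]
    refine expect_congr_fun fun F₂ hF₂ => ?_
    have e1 : (F₁ ∪ F₂) ∩ E₁ = F₁ := by
      rw [Finset.union_inter_distrib_right, Finset.inter_eq_left.2 hF₁,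
        Finset.disjoint_iff_inter_eq_empty.1 (h.symm.mono_left hF₂), Finset.union_empty]
    have e2 : (F₁ ∪ F₂) ∩ E₂ = F₂ := by
      rw [Finset.union_inter_distrib_right, Finset.inter_eq_left.2 hF₂,
        Finset.disjoint_iff_inter_eq_empty.1 (h.mono_left hF₁), Finset.empty_union]
    rw [e1, e2]
  · intro F _
    simp only [Finset.inter_assoc, Finset.inter_eq_right.2 Finset.subset_union_left,
      Finset.inter_eq_right.2 Finset.subset_union_right]

/-- The closed-edge form of the discrete derivative in the direction of `e`. -/
lemma one_sub_mul_expect_sub {α : Type*} [DecidableEq α] (p : α → ℝ) {E : Finset α} {e : α}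
    (he : e ∈ E) (f : Finset α → ℝ) :
    (1 - p e) * expect p E (fun F => f (insert e F) - f (F.erase e)) =
      expect p E (fun F => if e ∈ F then 0 else f (insert e F) - f F) := by
  rw [expect_erase p he, expect_erase p he]
  have hn : ∀ F ⊆ E.erase e, e ∉ F := fun F hF h => Finset.notMem_erase e E (hF h)
  rw [expect_congr_fun (f := fun F => f (insert e F) - f (F.erase e))
      (g := fun F => f (insert e F) - f F) fun F hF => by
        rw [Finset.erase_eq_of_notMem (hn F hF)],
    expect_congr_fun (f := fun F => f (insert e (insert e F)) - f ((insert e F).erase e))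
      (g := fun F => f (insert e F) - f F) fun F hF => by
        rw [Finset.insert_idem, Finset.erase_insert (hn F hF)],
    expect_congr_fun (f := fun F => if e ∈ F then 0 else f (insert e F) - f F)
      (g := fun F => f (insert e F) - f F) fun F hF => if_neg (hn F hF),
    expect_congr_fun (f := fun F => if e ∈ insert e F then 0 else
        f (insert e (insert e F)) - f (insert e F))
      (g := fun _ => 0) fun F _ => if_pos (Finset.mem_insert_self e F), expect_const]
  ring

section Sharpness

variable {V : Type*} [DecidableEq V]

/-- The indicator that `x` and `y` are connected. -/
noncomputable def connInd (F : Finset (Sym2 V)) (x y : V) : ℝ :=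
  if (bondGraph F).Reachable x y then 1 else 0

lemma connInd_nonneg (F : Finset (Sym2 V)) (x y : V) : 0 ≤ connInd F x y := by
  unfold connInd; split_ifs <;> norm_num

lemma connInd_mono (x y : V) : Monotone fun F : Finset (Sym2 V) => connInd F x y := by
  intro F F' h
  by_cases h1 : (bondGraph F).Reachable x y
  · simp [connInd, h1, reachable_mono h h1]
  · simpa [connInd, h1] using connInd_nonneg F' x y

/-- The expected number of open edges from the cluster of `o` within `S` to the set `T`, as in the
sharpness argument of Duminil-Copin and Tassion; `T` lies outside `S`. -/
noncomputable def boundaryFlow (p : Sym2 V → ℝ) (o : V) (S T : Finset V) : ℝ :=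
  ∑ x ∈ S, ∑ y ∈ T, expect p S.sym2 (fun F => connInd F o x) * p s(x, y)

lemma boundaryFlow_mono_right {p : Sym2 V → ℝ} (hp : ∀ e, 0 ≤ p e ∧ p e ≤ 1) (o : V)
    (S : Finset V) {T T' : Finset V} (h : T ⊆ T') :
    boundaryFlow p o S T ≤ boundaryFlow p o S T' :=
  Finset.sum_le_sum fun _ _ => Finset.sum_le_sum_of_subset_of_nonneg h fun _ _ _ =>
    mul_nonneg (expect_nonneg (fun e _ => hp e) fun F _ => connInd_nonneg F _ _) (hp _).1

lemma boundaryFlow_mono_param {p q : Sym2 V → ℝ} (hp : ∀ e, 0 ≤ p e) (hq : ∀ e, q e ≤ 1)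
    (hpq : ∀ e, p e ≤ q e) (o : V) (S T : Finset V) :
    boundaryFlow p o S T ≤ boundaryFlow q o S T :=
  Finset.sum_le_sum fun x _ => Finset.sum_le_sum fun _ _ =>
    mul_le_mul (expect_mono_param (fun e _ => hp e) (fun e _ => hpq e) (fun e _ => hq e)
      (connInd_mono o x)) (hpq _) (hp _)
      (expect_nonneg (fun e _ => ⟨(hp e).trans (hpq e), hq e⟩) fun F _ => connInd_nonneg F _ _)

/-- Explore the cluster `C` of `u` inside `S`: every vertex of the full cluster of `u` outside `S`
is reached through an edge from `C` to a vertex `y` outside `S`, and then off `C`. -/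
lemma clusterSize_le_card_add {Λ S : Finset V} {F : Finset (Sym2 V)} (hF : F ⊆ Λ.sym2) {u : V}
    (hu : u ∈ S) :
    (clusterSize F u : ℝ) ≤ S.card + ∑ x ∈ clusterOf (F ∩ S.sym2) {u}, ∑ y ∈ Λ \ S,
      (if s(x, y) ∈ F then 1 else 0) *
        (clusterSize (F.filter fun e => ¬Touches (clusterOf (F ∩ S.sym2) {u}) e) y : ℝ) := by
  set C := clusterOf (F ∩ S.sym2) {u} with hC
  set F' := F.filter fun e => ¬Touches C e with hF'
  have hCS : C ⊆ S := clusterOf_subset Finset.inter_subset_right (by simpa using hu)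
  have hsub : clusterOf F {u} ⊆ S ∪ C.biUnion fun x => (Λ \ S).biUnion fun y =>
      if s(x, y) ∈ F then clusterOf F' {y} else ∅ := by
    intro v hv
    have h1 : v ∈ C ∨ ∃ x ∈ C, ∃ y ∈ Λ \ S, s(x, y) ∈ F ∧ v ∈ clusterOf F' {y} := by
      refine reachable_induction (P := fun v => v ∈ C ∨ ∃ x ∈ C, ∃ y ∈ Λ \ S,
        s(x, y) ∈ F ∧ v ∈ clusterOf F' {y}) (mem_clusterOf_singleton.1 hv)
        (Or.inl (mem_clusterOf_self _ u)) fun b c _ hbc hb => ?_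
      by_cases hc : c ∈ C
      · exact Or.inl hc
      right
      by_cases hbC : b ∈ C
      · refine ⟨b, hbC, c, Finset.mem_sdiff.2 ⟨(Finset.mk_mem_sym2_iff.1 (hF hbc)).2, fun hcS =>
          hc ?_⟩, hbc, mem_clusterOf_self _ c⟩
        exact mem_clusterOf_of_edge hbC
          (Finset.mem_inter.2 ⟨hbc, Finset.mk_mem_sym2_iff.2 ⟨hCS hbC, hcS⟩⟩)
      · rcases hb with hb | ⟨x, hx, y, hy, hxy, hb⟩
        · exact absurd hb hbC
        · refine ⟨x, hx, y, hy, hxy, mem_clusterOf_of_edge hb (Finset.mem_filter.2 ⟨hbc, ?_⟩)⟩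
          rw [touches_mk]
          tauto
    rcases h1 with h1 | ⟨x, hx, y, hy, hxy, h⟩
    · exact Finset.mem_union_left _ (hCS h1)
    · refine Finset.mem_union_right _ (Finset.mem_biUnion.2 ⟨x, hx, Finset.mem_biUnion.2
        ⟨y, hy, ?_⟩⟩)
      rwa [if_pos hxy]
  have h2 : clusterSize F u ≤ S.card + ∑ x ∈ C, ∑ y ∈ Λ \ S,
      (if s(x, y) ∈ F then clusterSize F' y else 0) := by
    refine (Finset.card_le_card hsub).trans ((Finset.card_union_le _ _).trans
      (Nat.add_le_add_left ?_ _))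
    refine Finset.card_biUnion_le.trans (Finset.sum_le_sum fun x _ => ?_)
    refine Finset.card_biUnion_le.trans (Finset.sum_le_sum fun y _ => ?_)
    split_ifs
    · exact le_rfl
    · simp
  have h3 : (clusterSize F u : ℝ) ≤ S.card + ∑ x ∈ C, ∑ y ∈ Λ \ S,
      (if s(x, y) ∈ F then (clusterSize F' y : ℝ) else 0) := by exact_mod_cast h2
  simpa [ite_mul] using h3

lemma expect_clusterOf_eq_mul {p : Sym2 V → ℝ} {Λ S T : Finset V} (hS : S ⊆ Λ) (hT : T ⊆ S)
    {u x y : V} (hx : x ∈ T) (hy : y ∈ Λ \ S) :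
    expect p Λ.sym2 (fun F => (if clusterOf (F ∩ S.sym2) {u} = T then 1 else 0) *
      ((if s(x, y) ∈ F then 1 else 0) *
        (clusterSize (F.filter fun e => ¬Touches T e) y : ℝ))) =
      expect p S.sym2 (fun F => if clusterOf F {u} = T then 1 else 0) * (p s(x, y) *
        expect p (Λ.sym2.filter fun e => ¬Touches T e) (fun F => (clusterSize F y : ℝ))) := by
  obtain ⟨hyΛ, hyS⟩ := Finset.mem_sdiff.1 hy
  have hxS := hT hx
  set E₁ := S.sym2.filter (Touches T)
  set E₂ := Λ.sym2.filter fun e => ¬Touches T e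
  have hSΛ : S.sym2 ⊆ Λ.sym2 := Finset.sym2_mono hS
  have he : s(x, y) ∈ Λ.sym2 := Finset.mk_mem_sym2_iff.2 ⟨hS hxS, hyΛ⟩
  have het : Touches T s(x, y) := touches_mk.2 (Or.inl hx)
  have he2 : s(x, y) ∉ E₂ := fun h => (Finset.mem_filter.1 h).2 het
  have he1 : s(x, y) ∉ E₁ := fun h => hyS (Finset.mk_mem_sym2_iff.1 (Finset.mem_filter.1 h).1).2
  have hd : Disjoint E₁ ({s(x, y)} ∪ E₂) := by
    refine Finset.disjoint_left.2 fun e h1 h2 => ?_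
    rcases Finset.mem_union.1 h2 with h2 | h2
    · exact he1 (Finset.mem_singleton.1 h2 ▸ h1)
    · exact (Finset.mem_filter.1 h2).2 (Finset.mem_filter.1 h1).2
  have h2 : {s(x, y)} ∪ E₂ ⊆ Λ.sym2 :=
    Finset.union_subset (Finset.singleton_subset_iff.2 he) (Finset.filter_subset _ _)
  have hloc : ∀ F ⊆ S.sym2, (if clusterOf F {u} = T then (1 : ℝ) else 0) =
      if clusterOf (F ∩ E₁) {u} = T then 1 else 0 := fun F hF => by
    simp only [clusterOf_eq_iff_inter hF, E₁]
  rw [expect_local p (Finset.filter_subset _ _) hloc]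
  have h3 := expect_mul_of_disjoint p hd ((Finset.filter_subset _ _).trans hSΛ) h2
    (fun F => if clusterOf F {u} = T then (1 : ℝ) else 0)
    (fun F => (if s(x, y) ∈ F ∩ {s(x, y)} then (1 : ℝ) else 0) * (clusterSize (F ∩ E₂) y : ℝ))
  have h4 := expect_mul_of_disjoint p (Finset.disjoint_singleton_left.2 he2)
    Finset.subset_union_left Finset.subset_union_right
    (fun F => if s(x, y) ∈ F then (1 : ℝ) else 0) (fun F => (clusterSize F y : ℝ))
  have h5 : expect p {s(x, y)} (fun F => if s(x, y) ∈ F then (1 : ℝ) else 0) = p s(x, y) := by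
    rw [← insert_empty_eq, expect_insert p (Finset.notMem_empty _)]
    simp [expect_empty]
  rw [h4, h5] at h3
  rw [← h3]
  refine expect_congr_fun fun F hF => ?_
  have e1 : F ∩ E₁ = F ∩ S.sym2 ∩ E₁ := by
    rw [Finset.inter_assoc, Finset.inter_eq_right.2 (Finset.filter_subset _ S.sym2)]
  have e2 : F.filter (fun e => ¬Touches T e) = F ∩ ({s(x, y)} ∪ E₂) ∩ E₂ := by
    rw [Finset.inter_assoc, Finset.inter_eq_right.2 Finset.subset_union_right]
    ext e
    simp only [Finset.mem_filter, Finset.mem_inter, E₂]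
    exact ⟨fun h => ⟨h.1, hF h.1, h.2⟩, fun h => ⟨h.1, h.2.2⟩⟩
  rw [hloc _ Finset.inter_subset_right, e1, e2]
  simp

/-- If the boundary flow out of a bounded neighbourhood of each vertex is at most `1 / 2`, then the
clusters have bounded expected size. -/
theorem expect_clusterSize_le {p : Sym2 V → ℝ} (hp : ∀ e, 0 ≤ p e ∧ p e ≤ 1) {Λ : Finset V}
    {k : ℝ} (h : ∀ u ∈ Λ, ∃ S ⊆ Λ, u ∈ S ∧ (S.card : ℝ) ≤ k ∧
      boundaryFlow p u S (Λ \ S) ≤ 1 / 2) {u : V} (hu : u ∈ Λ) :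
    expect p Λ.sym2 (fun F => (clusterSize F u : ℝ)) ≤ 2 * k := by
  -- For a vertex `v` with the largest expected cluster size `m`, exploring `S` gives `m ≤ k + m / 2`.
  obtain ⟨v, hv, hmax⟩ := Finset.exists_max_image Λ
    (fun v => expect p Λ.sym2 (fun F => (clusterSize F v : ℝ))) ⟨u, hu⟩
  set m := expect p Λ.sym2 (fun F => (clusterSize F v : ℝ)) with hm
  have hm0 : 0 ≤ m := expect_nonneg (fun e _ => hp e) fun F _ => Nat.cast_nonneg _
  have hmono : ∀ y, Monotone fun F : Finset (Sym2 V) => (clusterSize F y : ℝ) :=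
    fun y _ _ h => Nat.cast_le.2 (clusterSize_mono y h)
  suffices hs : m ≤ k + m * (1 / 2) by linarith [hmax u hu]
  obtain ⟨S, hS, hvS, hk, hφ⟩ := h v hv
  have hpt : ∀ F ⊆ Λ.sym2, (clusterSize F v : ℝ) ≤ S.card + ∑ T ∈ S.powerset, ∑ x ∈ T,
      ∑ y ∈ Λ \ S, (if clusterOf (F ∩ S.sym2) {v} = T then 1 else 0) *
        ((if s(x, y) ∈ F then 1 else 0) *
          (clusterSize (F.filter fun e => ¬Touches T e) y : ℝ)) := by
    intro F hF
    refine (clusterSize_le_card_add hF hvS).trans (add_le_add le_rfl ?_)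
    have hC : clusterOf (F ∩ S.sym2) {v} ∈ S.powerset := Finset.mem_powerset.2
      (clusterOf_subset Finset.inter_subset_right (by simpa using hvS))
    refine le_trans (le_of_eq ?_) (Finset.single_le_sum (fun T _ => ?_) hC)
    · simp
    · refine Finset.sum_nonneg fun x _ => Finset.sum_nonneg fun y _ => ?_
      split_ifs <;> simp
  refine (expect_le_expect (fun e _ => hp e) hpt).trans ?_
  rw [expect_add, expect_const, expect_sum]
  refine add_le_add hk ?_
  calc ∑ T ∈ S.powerset, expect p Λ.sym2 (fun F => ∑ x ∈ T, ∑ y ∈ Λ \ S,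
        (if clusterOf (F ∩ S.sym2) {v} = T then 1 else 0) * ((if s(x, y) ∈ F then 1 else 0) *
          (clusterSize (F.filter fun e => ¬Touches T e) y : ℝ)))
      ≤ ∑ T ∈ S.powerset, ∑ x ∈ T, ∑ y ∈ Λ \ S,
        expect p S.sym2 (fun F => if clusterOf F {v} = T then 1 else 0) * (p s(x, y) * m) := by
        refine Finset.sum_le_sum fun T hT => ?_
        rw [expect_sum]
        refine Finset.sum_le_sum fun x hx => ?_
        rw [expect_sum]
        refine Finset.sum_le_sum fun y hy => ?_
        rw [expect_clusterOf_eq_mul hS (Finset.mem_powerset.1 hT) hx hy]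
        refine mul_le_mul_of_nonneg_left (mul_le_mul_of_nonneg_left ?_ (hp _).1) ?_
        · exact (expect_le_of_subset (Finset.filter_subset _ _) (fun e _ => hp e)
            (hmono y)).trans (hmax y (Finset.mem_sdiff.1 hy).1)
        · refine expect_nonneg (fun e _ => hp e) fun F _ => ?_
          split_ifs <;> norm_num
    _ = m * boundaryFlow p v S (Λ \ S) := by
        have h1 : ∀ x ∈ S, expect p S.sym2 (fun F => connInd F v x) = ∑ T ∈ S.powerset,
            if x ∈ T then expect p S.sym2 (fun F => if clusterOf F {v} = T then 1 else 0)
              else 0 := by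
          intro x hx
          rw [← Finset.sum_filter, ← expect_sum]
          refine expect_congr_fun fun F hF => ?_
          have hC : clusterOf F {v} ∈ S.powerset :=
            Finset.mem_powerset.2 (clusterOf_subset hF (by simpa using hvS))
          rw [Finset.sum_ite_eq]
          simp only [Finset.mem_filter, hC, true_and, mem_clusterOf_singleton, connInd]
        have h2 : ∀ T ∈ S.powerset, (∑ x ∈ T, ∑ y ∈ Λ \ S,
            expect p S.sym2 (fun F => if clusterOf F {v} = T then 1 else 0) * (p s(x, y) * m)) =
            ∑ x ∈ S, if x ∈ T then ∑ y ∈ Λ \ S,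
              expect p S.sym2 (fun F => if clusterOf F {v} = T then 1 else 0) * (p s(x, y) * m)
              else 0 := fun T hT => by
          rw [← Finset.sum_filter, Finset.filter_mem_eq_inter,
            Finset.inter_eq_right.2 (Finset.mem_powerset.1 hT)]
        rw [boundaryFlow, Finset.mul_sum, Finset.sum_congr rfl h2]
        rw [Finset.sum_comm]
        refine Finset.sum_congr rfl fun x hx => ?_
        rw [h1 x hx, Finset.mul_sum]
        simp only [Finset.sum_mul, Finset.mul_sum]
        rw [Finset.sum_comm (s := Λ \ S)]
        refine Finset.sum_congr rfl fun T _ => ?_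
        split_ifs
        · exact Finset.sum_congr rfl fun y _ => by ring
        · simp
    _ ≤ m * (1 / 2) := mul_le_mul_of_nonneg_left hφ hm0

end Sharpness

/-! ### The differential inequality for the connection probability -/

section SharpnessDerivative

variable {V : Type*} [DecidableEq V]

/-- The indicator that `o` is connected to `B`. -/
noncomputable def hitInd (o : V) (B : Finset V) (F : Finset (Sym2 V)) : ℝ :=
  if o ∈ clusterOf F B then 1 else 0

lemma hitInd_mono (o : V) (B : Finset V) : Monotone (hitInd o B) := by
  intro F F' h
  unfold hitInd
  by_cases h1 : o ∈ clusterOf F B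
  · simp [h1, clusterOf_mono h B h1]
  · simp only [h1, if_false]
    split_ifs <;> norm_num

lemma hitInd_le_one (o : V) (B : Finset V) (F : Finset (Sym2 V)) : hitInd o B F ≤ 1 := by
  unfold hitInd; split_ifs <;> norm_num

/-- The closed pivotal edges include all pairs joining the cluster of `o` to that of `B`. -/
lemma sum_connInd_le_sum_pivotal {J : Sym2 V → ℝ} (hJ : ∀ e, 0 ≤ J e) {Λ B T : Finset V} {o : V}
    {F : Finset (Sym2 V)} (hTΛ : T ⊆ Λ) (hT : clusterOf F B = T) (ho : o ∉ T) :
    ∑ x ∈ Λ \ T, ∑ y ∈ T, J s(x, y) * connInd (F ∩ (Λ \ T).sym2) o x ≤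
      ∑ e ∈ Λ.sym2, J e * (if e ∈ F then 0 else hitInd o B (insert e F) - hitInd o B F) := by
  set G : Sym2 V → ℝ := fun e =>
    J e * (if e ∈ F then 0 else hitInd o B (insert e F) - hitInd o B F) with hG
  have hG0 : ∀ e, 0 ≤ G e := fun e => mul_nonneg (hJ e) (by
    split_ifs
    · exact le_rfl
    · exact sub_nonneg.2 (hitInd_mono o B (Finset.subset_insert e F)))
  have hinj : Set.InjOn (fun z : V × V => s(z.1, z.2)) ((Λ \ T) ×ˢ T : Finset (V × V)) := by
    rintro ⟨x, y⟩ hz ⟨x', y'⟩ hz' h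
    simp only [Finset.coe_product, Set.mem_prod, Finset.mem_coe, Finset.mem_sdiff] at hz hz'
    rcases Sym2.eq_iff.1 h with ⟨h1, h2⟩ | ⟨h1, h2⟩
    · exact Prod.ext h1 h2
    · have hxy : x = y' := h1
      exact absurd (show x ∈ T from hxy ▸ hz'.2) hz.1.2
  have himg : ((Λ \ T) ×ˢ T).image (fun z : V × V => s(z.1, z.2)) ⊆ Λ.sym2 := by
    intro e he
    obtain ⟨⟨x, y⟩, hz, rfl⟩ := Finset.mem_image.1 he
    obtain ⟨hx, hy⟩ := Finset.mem_product.1 hz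
    exact Finset.mk_mem_sym2_iff.2 ⟨(Finset.mem_sdiff.1 hx).1, hTΛ hy⟩
  refine le_trans ?_ (Finset.sum_le_sum_of_subset_of_nonneg himg fun e _ _ => hG0 e)
  rw [Finset.sum_image hinj, Finset.sum_product]
  refine Finset.sum_le_sum fun x hx => Finset.sum_le_sum fun y hy => ?_
  change _ ≤ J _ * _
  refine mul_le_mul_of_nonneg_left ?_ (hJ _)
  obtain ⟨hxΛ, hxT⟩ := Finset.mem_sdiff.1 hx
  have he : s(x, y) ∉ F := fun h => by
    rw [← hT] at hy hxT
    exact hxT (mem_clusterOf_of_edge hy (Sym2.eq_swap ▸ h))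
  rw [if_neg he]
  have h0 : hitInd o B F = 0 := by simp [hitInd, hT, ho]
  rw [h0, sub_zero]
  unfold connInd
  split_ifs with h1
  · have h2 : (bondGraph F).Reachable o x := reachable_mono Finset.inter_subset_left h1
    rw [← hT] at hy
    obtain ⟨b, hb, hby⟩ := mem_clusterOf.1 hy
    have h3 : o ∈ clusterOf (insert s(x, y) F) B := mem_clusterOf.2 ⟨b, hb,
      reachable_insert.2 (Or.inr (Or.inr ⟨hby, h2.symm⟩))⟩
    simp [hitInd, h3]
  · unfold hitInd
    split_ifs <;> norm_num

/-- The differential inequality behind sharpness. -/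
lemma le_sum_deriv_hitInd {J : Sym2 V → ℝ} (hJ : ∀ e, 0 ≤ J e) {Λ D : Finset V}
    {o : V} (ho : o ∈ D) {b : ℝ} (hb : 0 < b) (hDΛ : D ⊆ Λ)
    (h : ∀ S ⊆ D, o ∈ S → 1 / 2 ≤ boundaryFlow (bondProb J b) o S (Λ \ S)) :
    1 / (2 * b) * (1 - expect (bondProb J b) Λ.sym2 (hitInd o (Λ \ D))) ≤
      ∑ e ∈ Λ.sym2, (J e * Real.exp (-(b * J e))) * expect (bondProb J b) Λ.sym2
        (fun F => hitInd o (Λ \ D) (insert e F) - hitInd o (Λ \ D) (F.erase e)) := by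
  set p := bondProb J b with hp
  set B := Λ \ D with hB
  have hp01 : ∀ e, 0 ≤ p e ∧ p e ≤ 1 := bondProb_mem hJ hb.le
  have h1 : ∀ e ∈ Λ.sym2, (J e * Real.exp (-(b * J e))) * expect p Λ.sym2
        (fun F => hitInd o B (insert e F) - hitInd o B (F.erase e)) =
      expect p Λ.sym2 (fun F => J e *
        (if e ∈ F then 0 else hitInd o B (insert e F) - hitInd o B F)) := by
    intro e he
    rw [expect_const_mul, ← one_sub_mul_expect_sub p he, mul_assoc]
    simp [hp, bondProb]
  rw [Finset.sum_congr rfl h1, ← expect_sum]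
  -- Decompose over the possible values `T` of the cluster of `B`. The event that it equals `T` is
  -- independent of the edges inside `Λ \ T`, where the flow from `o` is at least `1 / 2`.
  set 𝒯 := Λ.powerset.filter fun T => B ⊆ T ∧ o ∉ T with h𝒯
  let I : Finset V → Finset (Sym2 V) → ℝ := fun T F => if clusterOf F B = T then 1 else 0
  have hmem : ∀ F ⊆ Λ.sym2, (clusterOf F B ∈ 𝒯 ↔ o ∉ clusterOf F B) := by
    intro F hF
    simp only [h𝒯, Finset.mem_filter, Finset.mem_powerset, subset_clusterOf, true_and,
      and_iff_right_iff_imp]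
    exact fun _ => clusterOf_subset hF Finset.sdiff_subset
  have hone : ∑ T ∈ 𝒯, expect p Λ.sym2 (I T) = 1 - expect p Λ.sym2 (hitInd o B) := by
    rw [← expect_const p Λ.sym2 1, ← expect_sub, ← expect_sum]
    refine expect_congr_fun fun F hF => ?_
    simp only [I, hitInd]
    rw [Finset.sum_ite_eq]
    simp only [hmem F hF]
    by_cases hoF : o ∈ clusterOf F B <;> simp [hoF]
  have hpt : ∀ F ⊆ Λ.sym2, ∑ T ∈ 𝒯, ∑ x ∈ Λ \ T, ∑ y ∈ T,
      J s(x, y) * (I T F * connInd (F ∩ (Λ \ T).sym2) o x) ≤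
      ∑ e ∈ Λ.sym2, J e * (if e ∈ F then 0 else hitInd o B (insert e F) - hitInd o B F) := by
    intro F hF
    by_cases hoF : o ∈ clusterOf F B
    · rw [Finset.sum_eq_zero]
      · refine Finset.sum_nonneg fun e _ => mul_nonneg (hJ e) ?_
        split_ifs
        · exact le_rfl
        · exact sub_nonneg.2 (hitInd_mono o B (Finset.subset_insert e F))
      · intro T hT
        have : clusterOf F B ≠ T := by
          rintro rfl
          exact (hmem F hF).1 hT hoF
        simp [I, this]
    · have hT := (hmem F hF).2 hoF
      rw [Finset.sum_eq_single_of_mem _ hT]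
      · simp only [I, if_true, one_mul]
        exact sum_connInd_le_sum_pivotal hJ (clusterOf_subset hF Finset.sdiff_subset) rfl hoF
      · intro T _ hne
        simp [I, hne.symm]
  refine le_trans ?_ (expect_le_expect (fun e _ => hp01 e) hpt)
  rw [expect_sum, ← hone, Finset.mul_sum]
  refine Finset.sum_le_sum fun T hT => ?_
  obtain ⟨hTΛ, hBT, hoT⟩ := Finset.mem_filter.1 hT
  rw [Finset.mem_powerset] at hTΛ
  have hSD : Λ \ T ⊆ D := fun x hx => by
    obtain ⟨h1, h2⟩ := Finset.mem_sdiff.1 hx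
    by_contra h3
    exact h2 (hBT (Finset.mem_sdiff.2 ⟨h1, h3⟩))
  have hflow := h _ hSD (Finset.mem_sdiff.2 ⟨hDΛ ho, hoT⟩)
  rw [Finset.sdiff_sdiff_eq_self hTΛ] at hflow
  have hind : ∀ x, expect p Λ.sym2 (fun F => I T F * connInd (F ∩ (Λ \ T).sym2) o x) =
      expect p Λ.sym2 (I T) * expect p (Λ \ T).sym2 (fun F => connInd F o x) := by
    intro x
    have hd : Disjoint (Λ.sym2.filter (Touches T)) (Λ \ T).sym2 := by
      refine Finset.disjoint_left.2 fun e h1 h2 => ?_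
      obtain ⟨v, hve, hvT⟩ := (Finset.mem_filter.1 h1).2
      exact (Finset.mem_sdiff.1 (Finset.mem_sym2_iff.1 h2 v hve)).2 hvT
    have hloc : ∀ F ⊆ Λ.sym2, I T F = I T (F ∩ Λ.sym2.filter (Touches T)) := fun F hF => by
      simp only [I, clusterOf_eq_iff_inter hF]
    rw [expect_local p (Finset.filter_subset _ _) hloc,
      ← expect_mul_of_disjoint p hd (Finset.filter_subset _ _)
        (Finset.sym2_mono Finset.sdiff_subset) (I T) (fun F => connInd F o x)]
    exact expect_congr_fun fun F hF => by rw [hloc F hF]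
  have hI0 : 0 ≤ expect p Λ.sym2 (I T) := expect_nonneg (fun e _ => hp01 e) fun F _ => by
    simp only [I]; split_ifs <;> norm_num
  have h2 : boundaryFlow p o (Λ \ T) T ≤ b * ∑ x ∈ Λ \ T, ∑ y ∈ T,
      J s(x, y) * expect p (Λ \ T).sym2 (fun F => connInd F o x) := by
    rw [boundaryFlow, Finset.mul_sum]
    refine Finset.sum_le_sum fun x _ => ?_
    rw [Finset.mul_sum]
    refine Finset.sum_le_sum fun y _ => ?_
    have := mul_le_mul_of_nonneg_left (bondProb_le (J := J) b s(x, y))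
      (expect_nonneg (p := p) (E := (Λ \ T).sym2) (fun e _ => hp01 e)
        fun F _ => connInd_nonneg F o x)
    rw [← hp] at this
    linarith
  calc 1 / (2 * b) * expect p Λ.sym2 (I T)
      ≤ expect p Λ.sym2 (I T) * ∑ x ∈ Λ \ T, ∑ y ∈ T,
        J s(x, y) * expect p (Λ \ T).sym2 (fun F => connInd F o x) := by
        rw [mul_comm]
        refine mul_le_mul_of_nonneg_left ?_ hI0
        rw [div_le_iff₀ (by positivity)]
        linarith
    _ = _ := by
        rw [expect_sum, Finset.mul_sum]
        refine Finset.sum_congr rfl fun x _ => ?_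
        rw [expect_sum, Finset.mul_sum]
        refine Finset.sum_congr rfl fun y _ => ?_
        rw [expect_const_mul, hind]
        ring

lemma hasDerivAt_bondProb (J : Sym2 V → ℝ) (b : ℝ) (e : Sym2 V) :
    HasDerivAt (fun t => bondProb J t e) (J e * Real.exp (-(b * J e))) b := by
  have h1 : HasDerivAt (fun t : ℝ => -(t * J e)) (-(1 * J e)) b :=
    ((hasDerivAt_id b).mul_const (J e)).neg
  exact (h1.exp.const_sub 1).congr_deriv (by ring)

/-- If every boundary flow is at least `1 / 2` at `β₁`, then at any `β₂ > β₁` the probability of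
leaving `D` is bounded below, uniformly in `D`. -/
theorem le_expect_hitInd {J : Sym2 V → ℝ} (hJ : ∀ e, 0 ≤ J e) {Λ D : Finset V}
    {o : V} (ho : o ∈ D) (hDΛ : D ⊆ Λ) {β₁ β₂ : ℝ} (h1 : 0 ≤ β₁) (h12 : β₁ < β₂)
    (h : ∀ S ⊆ D, o ∈ S → 1 / 2 ≤ boundaryFlow (bondProb J β₁) o S (Λ \ S)) :
    1 - Real.exp (-((β₂ - β₁) / (2 * β₂))) ≤
      expect (bondProb J β₂) Λ.sym2 (hitInd o (Λ \ D)) := by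
  have hβ₂ : 0 < β₂ := h1.trans_lt h12
  set P : ℝ → ℝ := fun b => expect (bondProb J b) Λ.sym2 (hitInd o (Λ \ D)) with hP
  let P' : ℝ → ℝ := fun b => ∑ e ∈ Λ.sym2, (J e * Real.exp (-(b * J e))) *
    expect (bondProb J b) Λ.sym2
      (fun F => hitInd o (Λ \ D) (insert e F) - hitInd o (Λ \ D) (F.erase e))
  have hd : ∀ b, HasDerivAt P (P' b) b := fun b =>
    hasDerivAt_expect (fun e _ => hasDerivAt_bondProb J b e) _
  have hP1 : ∀ b, 0 ≤ b → P b ≤ 1 := fun b hb => by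
    have := expect_le_expect (p := bondProb J b) (E := Λ.sym2) (g := fun _ => 1)
      (fun e _ => bondProb_mem hJ hb e) fun F _ => hitInd_le_one o (Λ \ D) F
    rwa [expect_const] at this
  have hP0 : 0 ≤ P β₁ := expect_nonneg (fun e _ => bondProb_mem hJ h1 e) fun F _ => by
    unfold hitInd; split_ifs <;> norm_num
  let c := 1 / (2 * β₂)
  have hle : ∀ b ∈ Set.Ioo β₁ β₂, c * (1 - P b) ≤ P' b := by
    intro b ⟨hb1, hb2⟩
    have hb0 : 0 < b := h1.trans_lt hb1
    have h3 := le_sum_deriv_hitInd hJ ho hb0 hDΛ fun S hS hoS => (h S hS hoS).trans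
      (boundaryFlow_mono_param (fun e => (bondProb_mem hJ h1 e).1)
        (fun e => (bondProb_mem hJ hb0.le e).2) (fun e => bondProb_mono hJ hb1.le e) o S (Λ \ S))
    refine le_trans (mul_le_mul_of_nonneg_right ?_ (sub_nonneg.2 (hP1 b hb0.le))) h3
    exact one_div_le_one_div_of_le (by positivity) (by linarith)
  have hanti : AntitoneOn (fun t => Real.exp (c * t) * (1 - P t)) (Set.Icc β₁ β₂) := by
    have hder : ∀ t, HasDerivAt (fun t => Real.exp (c * t) * (1 - P t))
        (Real.exp (c * t) * (c * (1 - P t) - P' t)) t := fun t => by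
      have e1 : HasDerivAt (fun t : ℝ => c * t) (c * 1) t := (hasDerivAt_id t).const_mul c
      exact (e1.exp.mul ((hd t).const_sub 1)).congr_deriv (by ring)
    refine antitoneOn_of_deriv_nonpos (convex_Icc _ _)
      (fun t _ => (hder t).continuousAt.continuousWithinAt)
      (fun t _ => (hder t).differentiableAt.differentiableWithinAt) fun t ht => ?_
    rw [interior_Icc] at ht
    rw [(hder t).deriv]
    exact mul_nonpos_of_nonneg_of_nonpos (Real.exp_pos _).le (by linarith [hle t ht])
  have h4 := hanti (Set.left_mem_Icc.2 h12.le) (Set.right_mem_Icc.2 h12.le) h12.le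
  simp only at h4
  have h5 : 1 - P β₂ ≤ Real.exp (c * β₁ - c * β₂) := by
    rw [Real.exp_sub, le_div_iff₀ (Real.exp_pos _)]
    have := mul_le_mul_of_nonneg_left (show 1 - P β₁ ≤ 1 by linarith) (Real.exp_pos (c * β₁)).le
    linarith
  have h6 : c * β₁ - c * β₂ = -((β₂ - β₁) / (2 * β₂)) := by
    simp only [c]
    ring
  rw [h6] at h5
  linarith

end SharpnessDerivative

/-! ### Finite volumes of the lattice -/

section Volumes

variable {d : ℕ}

lemma edgeWeight_mk (J : Intensity d) (x y : Lattice d) : edgeWeight J s(x, y) = J (y - x) := rfl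

/-- The probability that the cluster of `x` in the finite volume `Λ` has at least `n` vertices. -/
noncomputable def volumeTail (J : Intensity d) (β : ℝ) (Λ : Finset (Lattice d)) (n : ℕ)
    (x : Lattice d) : ℝ :=
  expect (bondProb (edgeWeight J) β) Λ.sym2 (fun F => atLeast n (clusterSize F x))

/-- The probability that `x` and `y` are connected in the finite volume `Λ`. -/
noncomputable def volumeConn (J : Intensity d) (β : ℝ) (Λ : Finset (Lattice d))
    (x y : Lattice d) : ℝ :=
  expect (bondProb (edgeWeight J) β) Λ.sym2 (fun F => connInd F x y)

lemma bondProb_edgeWeight_mem (J : Intensity d) {β : ℝ} (hβ : 0 ≤ β) (e : Sym2 (Lattice d)) :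
    0 ≤ bondProb (edgeWeight J) β e ∧ bondProb (edgeWeight J) β e ≤ 1 :=
  bondProb_mem (edgeWeight_nonneg J) hβ e

lemma sum_edgeWeight_le (J : Intensity d) (Λ : Finset (Lattice d)) (x : Lattice d) :
    ∑ y ∈ Λ, edgeWeight J s(x, y) ≤ ∑' z, J z := by
  have h1 : ∑ y ∈ Λ, edgeWeight J s(x, y) = ∑ z ∈ Λ.image (fun y => y - x), J z := by
    rw [Finset.sum_image fun a _ b _ h => sub_left_injective h]
    rfl
  rw [h1]
  exact J.summable.sum_le_tsum _ fun z _ => J.nonneg z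

lemma expect_translate (J : Intensity d) (β : ℝ) (Λ : Finset (Lattice d)) (v : Lattice d)
    (f : Finset (Sym2 (Lattice d)) → ℝ) :
    expect (bondProb (edgeWeight J) β) (Λ.image (Equiv.addRight v)).sym2 f =
      expect (bondProb (edgeWeight J) β) Λ.sym2
        (fun F => f (F.image (Sym2.map (Equiv.addRight v)))) := by
  rw [Finset.sym2_image, expect_image _ (Sym2.map.injective (Equiv.addRight v).injective)]
  refine expect_congr (fun e _ => ?_) fun _ _ => rfl
  induction e with
  | h x y =>
    simp only [Function.comp, Sym2.map_mk, bondProb, edgeWeight_mk]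
    simp

lemma volumeTail_translate (J : Intensity d) (β : ℝ) (Λ : Finset (Lattice d)) (n : ℕ)
    (x v : Lattice d) :
    volumeTail J β (Λ.image (Equiv.addRight v)) n (x + v) = volumeTail J β Λ n x := by
  rw [volumeTail, expect_translate]
  refine expect_congr_fun fun F _ => ?_
  have := clusterOf_image (Equiv.addRight v) F x
  rw [Equiv.coe_addRight] at this
  rw [clusterSize, Equiv.coe_addRight, this, Finset.card_image_of_injective _ (add_left_injective v),
    clusterSize]

lemma volumeConn_translate (J : Intensity d) (β : ℝ) (Λ : Finset (Lattice d))
    (x y v : Lattice d) :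
    volumeConn J β (Λ.image (Equiv.addRight v)) (x + v) (y + v) = volumeConn J β Λ x y := by
  rw [volumeConn, expect_translate]
  refine expect_congr_fun fun F _ => ?_
  have := reachable_image_iff (Equiv.addRight v) (F := F) (x := x) (y := y)
  rw [Equiv.coe_addRight] at this
  simp only [connInd, Equiv.coe_addRight, this]

lemma volumeTail_mono (J : Intensity d) {β : ℝ} (hβ : 0 ≤ β) {Λ Λ' : Finset (Lattice d)}
    (h : Λ ⊆ Λ') (n : ℕ) (x : Lattice d) : volumeTail J β Λ n x ≤ volumeTail J β Λ' n x :=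
  expect_le_of_subset (Finset.sym2_mono h) (fun e _ => bondProb_edgeWeight_mem J hβ e)
    fun _ _ h => atLeast_mono n (clusterSize_mono x h)

lemma volumeConn_mono (J : Intensity d) {β : ℝ} (hβ : 0 ≤ β) {Λ Λ' : Finset (Lattice d)}
    (h : Λ ⊆ Λ') (x y : Lattice d) : volumeConn J β Λ x y ≤ volumeConn J β Λ' x y :=
  expect_le_of_subset (Finset.sym2_mono h) (fun e _ => bondProb_edgeWeight_mem J hβ e)
    (connInd_mono x y)

lemma volumeTail_mono_param (J : Intensity d) {β β' : ℝ} (hβ : 0 ≤ β) (h : β ≤ β')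
    (Λ : Finset (Lattice d)) (n : ℕ) (x : Lattice d) :
    volumeTail J β Λ n x ≤ volumeTail J β' Λ n x :=
  expect_mono_param (fun e _ => (bondProb_edgeWeight_mem J hβ e).1)
    (fun e _ => bondProb_mono (edgeWeight_nonneg J) h e)
    (fun e _ => (bondProb_edgeWeight_mem J (hβ.trans h) e).2)
    fun _ _ h => atLeast_mono n (clusterSize_mono x h)

lemma volumeTail_nonneg (J : Intensity d) {β : ℝ} (hβ : 0 ≤ β) (Λ : Finset (Lattice d)) (n : ℕ)
    (x : Lattice d) : 0 ≤ volumeTail J β Λ n x :=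
  expect_nonneg (fun e _ => bondProb_edgeWeight_mem J hβ e) fun _ _ => atLeast_nonneg _ _

/-- The box `[-N, N]^d`. -/
noncomputable def box (d N : ℕ) : Finset (Lattice d) := Fintype.piFinset fun _ => Finset.Icc (-(N : ℤ)) N

lemma mem_box {N : ℕ} {x : Lattice d} : x ∈ box d N ↔ ∀ i, -(N : ℤ) ≤ x i ∧ x i ≤ N := by
  simp [box]

lemma box_mono {N M : ℕ} (h : N ≤ M) : box d N ⊆ box d M := by
  intro x hx
  rw [mem_box] at hx ⊢
  intro i
  have := hx i
  omega

lemma zero_mem_box (N : ℕ) : (0 : Lattice d) ∈ box d N := mem_box.2 fun i => by simp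

lemma exists_subset_box (s : Finset (Lattice d)) : ∃ N, s ⊆ box d N := by
  refine ⟨s.sup fun x => Finset.univ.sup fun i => (x i).natAbs, fun x hx => mem_box.2 fun i => ?_⟩
  have h1 : (x i).natAbs ≤ s.sup fun x => Finset.univ.sup fun i => (x i).natAbs :=
    (Finset.le_sup (f := fun i => (x i).natAbs) (Finset.mem_univ i)).trans
      (Finset.le_sup (f := fun x : Lattice d => Finset.univ.sup fun i => (x i).natAbs) hx)
  omega

lemma card_box (N : ℕ) : (box d N).card = (2 * N + 1) ^ d := by
  simp only [box, Fintype.card_piFinset, Int.card_Icc, Finset.prod_const, Finset.card_univ,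
    Fintype.card_fin]
  congr 1
  omega

/-- The box `(r, 2r]^d`. -/
noncomputable def orthantBox (d r : ℕ) : Finset (Lattice d) :=
  Fintype.piFinset fun _ => Finset.Ioc (r : ℤ) (2 * r)

lemma mem_orthantBox {r : ℕ} {x : Lattice d} :
    x ∈ orthantBox d r ↔ ∀ i, (r : ℤ) < x i ∧ x i ≤ 2 * r := by
  simp [orthantBox]

lemma card_orthantBox (r : ℕ) : (orthantBox d r).card = r ^ d := by
  simp only [orthantBox, Fintype.card_piFinset, Int.card_Ioc, Finset.prod_const, Finset.card_univ,
    Fintype.card_fin]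
  congr 1
  omega

lemma l1norm_le_of_mem_orthantBox {r : ℕ} {z : Lattice d} (hz : z ∈ orthantBox d r) :
    l1norm z ≤ 2 * d * r := by
  have h : ∀ i ∈ Finset.univ, |(z i : ℝ)| ≤ 2 * r := fun i _ => by
    obtain ⟨h1, h2⟩ := mem_orthantBox.1 hz i
    have h3 : (z i : ℝ) ≤ 2 * r := by exact_mod_cast h2
    have h4 : (r : ℝ) < z i := by exact_mod_cast h1
    rw [abs_of_nonneg ((Nat.cast_nonneg r).trans h4.le)]
    exact h3
  calc l1norm z ≤ ∑ _i : Fin d, (2 * r : ℝ) := Finset.sum_le_sum h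
    _ = 2 * d * r := by
      rw [Finset.sum_const, Finset.card_univ, Fintype.card_fin, nsmul_eq_mul]
      ring

lemma le_l1norm_of_mem_orthantBox (hd : 1 ≤ d) {r : ℕ} {z : Lattice d}
    (hz : z ∈ orthantBox d r) : (r : ℝ) ≤ l1norm z := by
  let i : Fin d := ⟨0, hd⟩
  have h4 : (r : ℝ) < z i := by exact_mod_cast (mem_orthantBox.1 hz i).1
  exact (h4.le.trans (le_abs_self _)).trans
    (Finset.single_le_sum (f := fun i => |(z i : ℝ)|) (fun i _ => abs_nonneg _)
      (Finset.mem_univ i))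

/-- Pairs with displacement in the open orthant are counted once. -/
lemma sum_orthant_le_sum_sym2 (hd : 1 ≤ d) {Λ' Λ Z : Finset (Lattice d)}
    (hZ : ∀ z ∈ Z, ∀ i, 0 < z i) (hΛ' : Λ' ⊆ Λ) (h : ∀ x ∈ Λ', ∀ z ∈ Z, x + z ∈ Λ)
    {G : Sym2 (Lattice d) → ℝ} (hG : ∀ e, 0 ≤ G e) :
    ∑ x ∈ Λ', ∑ z ∈ Z, G s(x, x + z) ≤ ∑ e ∈ Λ.sym2, G e := by
  have hinj : Set.InjOn (fun q : Lattice d × Lattice d => s(q.1, q.1 + q.2))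
      (Λ' ×ˢ Z : Finset (Lattice d × Lattice d)) := by
    rintro ⟨x, z⟩ hz ⟨x', z'⟩ hz' h
    simp only [Finset.coe_product, Set.mem_prod, Finset.mem_coe] at hz hz'
    rcases Sym2.eq_iff.1 h with ⟨h1, h2⟩ | ⟨h1, h2⟩
    · have h1' : x = x' := h1
      subst h1'
      exact Prod.ext rfl (add_left_cancel h2)
    · have e1 := congrFun h1 ⟨0, hd⟩
      have e2 := congrFun h2 ⟨0, hd⟩
      have e3 := hZ z hz.2 ⟨0, hd⟩
      have e4 := hZ z' hz'.2 ⟨0, hd⟩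
      simp only [Pi.add_apply] at e1 e2
      omega
  have himg : (Λ' ×ˢ Z).image (fun q : Lattice d × Lattice d => s(q.1, q.1 + q.2)) ⊆ Λ.sym2 := by
    intro e he
    obtain ⟨⟨x, z⟩, hq, rfl⟩ := Finset.mem_image.1 he
    obtain ⟨hx, hz⟩ := Finset.mem_product.1 hq
    exact Finset.mk_mem_sym2_iff.2 ⟨hΛ' hx, h x hx z hz⟩
  refine le_trans (le_of_eq ?_) (Finset.sum_le_sum_of_subset_of_nonneg himg fun e _ _ => hG e)
  rw [Finset.sum_image hinj, Finset.sum_product]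

/-- By the Harris inequality, two points that are unlikely to be connected are likely to lie in
distinct large clusters. -/
lemma volumeTail_sq_sub_volumeConn_le (J : Intensity d) {β : ℝ} (hβ : 0 ≤ β) {Λ₀ Λ₁ Λ : Finset
    (Lattice d)} {x z : Lattice d} (n : ℕ) (h0 : Λ₀.image (Equiv.addRight x) ⊆ Λ)
    (h1 : Λ₀.image (Equiv.addRight (x + z)) ⊆ Λ) (h2 : Λ ⊆ Λ₁.image (Equiv.addRight x)) :
    volumeTail J β Λ₀ n 0 ^ 2 - volumeConn J β Λ₁ 0 z ≤
      expect (bondProb (edgeWeight J) β) Λ.sym2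
        (fun F => ghostPair (atLeast n) F s(x, x + z)) := by
  set p := bondProb (edgeWeight J) β with hp
  have hp01 : ∀ e ∈ Λ.sym2, 0 ≤ p e ∧ p e ≤ 1 := fun e _ => bondProb_edgeWeight_mem J hβ e
  have e1 : volumeTail J β Λ₀ n 0 ≤ volumeTail J β Λ n x := by
    have := volumeTail_mono J hβ h0 n x
    have h := volumeTail_translate J β Λ₀ n 0 x
    rw [zero_add] at h
    rwa [h] at this
  have e2 : volumeTail J β Λ₀ n 0 ≤ volumeTail J β Λ n (x + z) := by
    have := volumeTail_mono J hβ h1 n (x + z)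
    have h := volumeTail_translate J β Λ₀ n 0 (x + z)
    rw [zero_add] at h
    rwa [h] at this
  have e3 : volumeConn J β Λ x (x + z) ≤ volumeConn J β Λ₁ 0 z := by
    have := volumeConn_mono J hβ h2 x (x + z)
    have h := volumeConn_translate J β Λ₁ 0 z x
    rw [zero_add, add_comm z x] at h
    rwa [h] at this
  have e4 : volumeTail J β Λ n x * volumeTail J β Λ n (x + z) ≤ expect p Λ.sym2
      (fun F => atLeast n (clusterSize F x) * atLeast n (clusterSize F (x + z))) :=
    expect_mul_le_expect_mul hp01 (fun _ _ h => atLeast_mono n (clusterSize_mono _ h))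
      fun _ _ h => atLeast_mono n (clusterSize_mono _ h)
  have e5 : expect p Λ.sym2 (fun F => atLeast n (clusterSize F x) *
      atLeast n (clusterSize F (x + z)) - connInd F x (x + z)) ≤
      expect p Λ.sym2 (fun F => ghostPair (atLeast n) F s(x, x + z)) := by
    refine expect_le_expect hp01 fun F _ => ?_
    rw [ghostPair_mk, connInd]
    split_ifs
    · have := mul_le_mul (atLeast_le_one n (clusterSize F x))
        (atLeast_le_one n (clusterSize F (x + z))) (atLeast_nonneg _ _) zero_le_one
      linarith
    · linarith
  rw [expect_sub] at e5
  have e6 := mul_le_mul e1 e2 (volumeTail_nonneg J hβ Λ₀ n 0) (volumeTail_nonneg J hβ Λ n x)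
  have e7 : volumeConn J β Λ x (x + z) = expect p Λ.sym2 (fun F => connInd F x (x + z)) := rfl
  rw [sq]
  linarith

/-- Averaging the two-ghost inequality over the pairs with displacement in `Z`. -/
theorem card_mul_volumeTail_sq_le (hd : 1 ≤ d) (J : Intensity d) {β : ℝ} (hβ : 0 < β) {n : ℕ}
    (hn : 1 ≤ n) (R : ℕ) {Z : Finset (Lattice d)} (hZ : ∀ z ∈ Z, ∀ i, 0 < z i) {j : ℝ}
    (hj : 0 < j) (hJj : ∀ z ∈ Z, j ≤ J z) :
    ∃ Λ : Finset (Lattice d), Z.card * volumeTail J β (box d R) n 0 ^ 2 ≤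
      ∑ z ∈ Z, volumeConn J β Λ 0 z +
        2 ^ d * (48 * Real.exp 4 * (∑' z, J z + 1 / β)) / (j * Real.sqrt n) := by
  obtain ⟨r, hr⟩ := exists_subset_box Z
  -- Only the points of the inner box of radius `M` are used, so that all translates stay in the box
  -- of radius `N`; its volume is a positive fraction of the whole.
  set M := R + r with hM
  set N := 2 * M with hN
  refine ⟨box d (2 * N), ?_⟩
  set t := volumeTail J β (box d R) n 0
  set C := 48 * Real.exp 4 * (∑' z, J z + 1 / β) with hC
  have htsum : 0 ≤ ∑' z, J z := tsum_nonneg J.nonneg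
  have hC0 : 0 ≤ C := by positivity
  have hp01 : ∀ e ∈ (box d N).sym2, 0 ≤ bondProb (edgeWeight J) β e ∧
    bondProb (edgeWeight J) β e ≤ 1 := fun e _ => bondProb_edgeWeight_mem J hβ.le e
  have hghost : ∀ e, 0 ≤ expect (bondProb (edgeWeight J) β) (box d N).sym2
      (fun F => ghostPair (atLeast n) F e) := fun e => expect_nonneg hp01 fun F _ => by
    induction e with
    | h x y =>
      rw [ghostPair_mk]
      split_ifs
      · exact le_rfl
      · exact mul_nonneg (atLeast_nonneg _ _) (atLeast_nonneg _ _)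
  have h1 := sum_orthant_le_sum_sym2 hd (Λ' := box d M) (Λ := box d N) hZ (box_mono (by omega))
    (fun x hx z hz => mem_box.2 fun i => by
      have e1 := mem_box.1 hx i
      have e2 := mem_box.1 (hr hz) i
      simp only [Pi.add_apply]
      omega)
    (fun e => mul_nonneg (edgeWeight_nonneg J e) (hghost e))
  have h2 := h1.trans (twoGhost_inequality (edgeWeight_nonneg J) hβ (sum_edgeWeight_le J) hn
    (box d N))
  have h3 : ∀ x ∈ box d M, ∀ z ∈ Z, j * (t ^ 2 - volumeConn J β (box d (2 * N)) 0 z) ≤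
      edgeWeight J s(x, x + z) * expect (bondProb (edgeWeight J) β) (box d N).sym2
        (fun F => ghostPair (atLeast n) F s(x, x + z)) := by
    intro x hx z hz
    have hx' := mem_box.1 hx
    have hz' := mem_box.1 (hr hz)
    have e1 : edgeWeight J s(x, x + z) = J z := by rw [edgeWeight_mk, add_sub_cancel_left]
    rw [e1]
    refine le_trans (mul_le_mul_of_nonneg_left ?_ hj.le)
      (mul_le_mul_of_nonneg_right (hJj z hz) (hghost _))
    refine volumeTail_sq_sub_volumeConn_le J hβ.le n ?_ ?_ ?_
    · intro y hy
      obtain ⟨w, hw, rfl⟩ := Finset.mem_image.1 hy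
      refine mem_box.2 fun i => ?_
      have := mem_box.1 hw i
      have := hx' i
      simp only [Equiv.coe_addRight, Pi.add_apply]
      omega
    · intro y hy
      obtain ⟨w, hw, rfl⟩ := Finset.mem_image.1 hy
      refine mem_box.2 fun i => ?_
      have := mem_box.1 hw i
      have := hx' i
      have := hz' i
      simp only [Equiv.coe_addRight, Pi.add_apply]
      omega
    · intro y hy
      refine Finset.mem_image.2 ⟨y - x, mem_box.2 fun i => ?_, by simp⟩
      have := mem_box.1 hy i
      have := hx' i
      simp only [Pi.sub_apply]
      omega
  have h4 := (Finset.sum_le_sum fun x hx => Finset.sum_le_sum fun z hz => h3 x hx z hz).trans h2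
  rw [Finset.sum_const, nsmul_eq_mul, ← Finset.mul_sum, Finset.sum_sub_distrib, Finset.sum_const,
    nsmul_eq_mul] at h4
  have hbM : (0 : ℝ) < (box d M).card := by
    rw [card_box]; positivity
  have hbN : ((box d N).card : ℝ) ≤ 2 ^ d * (box d M).card := by
    rw [card_box, card_box]
    push_cast
    rw [← mul_pow]
    refine pow_le_pow_left₀ (by positivity) ?_ d
    rw [hN]
    push_cast
    linarith
  have hsq : 0 < Real.sqrt n := Real.sqrt_pos.2 (by exact_mod_cast hn)
  set W := ∑ z ∈ Z, volumeConn J β (box d (2 * N)) 0 z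
  have h5 : (box d M).card * (j * (Z.card * t ^ 2 - W)) ≤
      (box d M).card * (2 ^ d * C / Real.sqrt n) := by
    refine h4.trans ?_
    rw [← hC]
    calc C * (box d N).card / Real.sqrt n ≤ C * (2 ^ d * (box d M).card) / Real.sqrt n := by
          gcongr
      _ = _ := by ring
  have h6 := le_of_mul_le_mul_left h5 hbM
  have h7 : Z.card * t ^ 2 - W ≤ 2 ^ d * C / (j * Real.sqrt n) := by
    rw [mul_comm j, ← le_div_iff₀ hj, div_div, mul_comm (Real.sqrt n)] at h6
    exact h6
  linarith

lemma sum_volumeConn_le (J : Intensity d) {β : ℝ} (hβ : 0 ≤ β) (Λ Z : Finset (Lattice d)) :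
    ∑ z ∈ Z, volumeConn J β Λ 0 z ≤ ∑ k ∈ Finset.range Z.card, volumeTail J β Λ (k + 1) 0 := by
  simp only [volumeConn, volumeTail]
  rw [← expect_sum, ← expect_sum]
  refine expect_le_expect (fun e _ => bondProb_edgeWeight_mem J hβ e) fun F _ => ?_
  have h1 : ∑ z ∈ Z, connInd F 0 z = ((Z.filter fun z => z ∈ clusterOf F {0}).card : ℝ) := by
    simp only [connInd, mem_clusterOf_singleton]
    rw [Finset.sum_boole]
  have h2 : ∑ k ∈ Finset.range Z.card, atLeast (k + 1) (clusterSize F 0) =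
      (((Finset.range Z.card).filter fun k => k + 1 ≤ clusterSize F 0).card : ℝ) := by
    simp only [atLeast]
    rw [Finset.sum_boole]
  rw [h1, h2]
  have h3 : (Finset.range Z.card).filter (fun k => k + 1 ≤ clusterSize F 0) =
      Finset.range (min Z.card (clusterSize F 0)) := by
    ext k
    simp only [Finset.mem_filter, Finset.mem_range]
    omega
  rw [h3, Finset.card_range]
  refine Nat.cast_le.2 (le_min (Finset.card_filter_le _ _) (Finset.card_le_card fun z hz => ?_))
  exact (Finset.mem_filter.1 hz).2

end Volumes

/-! ### The bootstrap -/

section Bootstrap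

variable {d : ℕ}

/-- Summability of `J` forces the decay exponent `α` to be positive. -/
lemma alpha_pos (hd : 1 ≤ d) (J : Intensity d) {α c r₀ : ℝ} (hc : 0 < c)
    (hJ : ∀ x : Lattice d, r₀ ≤ l1norm x → c * l1norm x ^ (-(d : ℝ) - α) ≤ J x) : 0 < α := by
  by_contra hα
  push Not at hα
  have hd0 : (0 : ℝ) < d := by exact_mod_cast hd
  set ε := c * (2 * d : ℝ) ^ (-(d : ℝ)) with hε
  have hε0 : 0 < ε := by positivity
  obtain ⟨s, hs⟩ := summable_iff_vanishing_norm.1 J.summable ε hε0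
  obtain ⟨N, hN⟩ := exists_subset_box s
  set r := max (max N 1) ⌈r₀⌉₊ with hr
  have hrN : N ≤ r := (le_max_left _ _).trans (le_max_left _ _)
  have hr1 : 1 ≤ r := (le_max_right _ _).trans (le_max_left _ _)
  have hr0 : r₀ ≤ r := (Nat.le_ceil r₀).trans (by exact_mod_cast le_max_right _ _)
  have hr1' : (1 : ℝ) ≤ r := by exact_mod_cast hr1
  have hdisj : Disjoint (orthantBox d r) s := Finset.disjoint_left.2 fun z hz hzs => by
    have h1 := (mem_orthantBox.1 hz ⟨0, hd⟩).1
    have h2 := (mem_box.1 (hN hzs) ⟨0, hd⟩).2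
    omega
  have h1 := hs _ hdisj
  have h2 : ∑ z ∈ orthantBox d r, c * (2 * d * r : ℝ) ^ (-(d : ℝ)) ≤ ∑ z ∈ orthantBox d r, J z := by
    refine Finset.sum_le_sum fun z hz => ?_
    have e1 := le_l1norm_of_mem_orthantBox hd hz
    have e2 := l1norm_le_of_mem_orthantBox hz
    have e3 : 1 ≤ l1norm z := hr1'.trans e1
    refine le_trans (mul_le_mul_of_nonneg_left ?_ hc.le) (hJ z (hr0.trans e1))
    calc (2 * d * r : ℝ) ^ (-(d : ℝ)) ≤ l1norm z ^ (-(d : ℝ)) :=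
          Real.rpow_le_rpow_of_nonpos (by linarith) e2 (by linarith)
      _ ≤ _ := Real.rpow_le_rpow_of_exponent_le e3 (by linarith)
  have h3 : ∑ z ∈ orthantBox d r, c * (2 * d * r : ℝ) ^ (-(d : ℝ)) = ε := by
    rw [Finset.sum_const, card_orthantBox, nsmul_eq_mul, Real.mul_rpow (by positivity)
      (by positivity), hε, Real.rpow_neg (by positivity : (0 : ℝ) ≤ r), Real.rpow_natCast]
    push_cast
    have : (r : ℝ) ^ d ≠ 0 := by positivity
    field_simp
  rw [h3] at h2
  rw [Real.norm_eq_abs] at h1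
  linarith [le_abs_self (∑ z ∈ orthantBox d r, J z)]

lemma sum_rpow_neg_le {θ : ℝ} (h0 : 0 ≤ θ) (h1 : θ ≤ 1 / 2) (m : ℕ) :
    ∑ k ∈ Finset.range m, ((k + 1 : ℕ) : ℝ) ^ (-θ) ≤ 2 * (m : ℝ) ^ (1 - θ) := by
  induction m with
  | zero =>
    rw [Finset.sum_range_zero]
    positivity
  | succ m ih =>
    rw [Finset.sum_range_succ]
    set x : ℝ := ((m + 1 : ℕ) : ℝ) with hx
    have hx1 : 1 ≤ x := by rw [hx]; exact_mod_cast Nat.succ_le_succ (Nat.zero_le m)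
    have hx0 : 0 < x := by linarith
    have hm : (m : ℝ) = x * (1 + (-(1 / x))) := by
      have : x = m + 1 := by rw [hx]; push_cast; ring
      field_simp
      linarith
    have h2 : (1 + (-(1 / x))) ^ (1 - θ) ≤ 1 + (1 - θ) * (-(1 / x)) :=
      rpow_one_add_le_one_add_mul_self
        (by have : 1 / x ≤ 1 := by rw [div_le_one hx0]; exact hx1
            linarith) (by linarith) (by linarith)
    have h3 : (0 : ℝ) ≤ 1 + (-(1 / x)) := by
      have : 1 / x ≤ 1 := by rw [div_le_one hx0]; exact hx1
      linarith
    have h4 : (m : ℝ) ^ (1 - θ) ≤ x ^ (1 - θ) * (1 + (1 - θ) * (-(1 / x))) := by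
      rw [hm, Real.mul_rpow hx0.le h3]
      exact mul_le_mul_of_nonneg_left h2 (by positivity)
    have h5 : x ^ (1 - θ) = x * x ^ (-θ) := by
      rw [sub_eq_add_neg, Real.rpow_add hx0, Real.rpow_one]
    have h6 : x ^ (1 - θ) * (1 + (1 - θ) * (-(1 / x))) = x ^ (1 - θ) - (1 - θ) * x ^ (-θ) := by
      rw [h5]
      field_simp
      ring
    have h7 : 0 < x ^ (-θ) := by positivity
    nlinarith

/-- The improved bound in the bootstrap, at side length `r ≍ n ^ (2 / d)`. -/
theorem volumeTail_sq_le (hd : 1 ≤ d) (J : Intensity d) {α c r₀ : ℝ} (hα : α < (d : ℝ) / 4)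
    (hc : 0 < c) (hJ : ∀ x : Lattice d, r₀ ≤ l1norm x → c * l1norm x ^ (-(d : ℝ) - α) ≤ J x)
    {θ : ℝ} (hθ : θ = ((d : ℝ) - 4 * α) / (4 * (d : ℝ))) {β : ℝ} (hβ : 0 < β) {A : ℝ}
    (hA0 : 0 ≤ A) (hA : ∀ (Λ : Finset (Lattice d)) (k : ℕ), 1 ≤ k →
      volumeTail J β Λ k 0 ≤ A * (k : ℝ) ^ (-θ)) (R : ℕ) {n : ℕ} (hn : 1 ≤ n) :
    ((n : ℝ) ^ θ * volumeTail J β (box d R) n 0) ^ 2 ≤ 2 * A +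
      2 ^ d * (48 * Real.exp 4 * (∑' z, J z + 1 / β)) *
        ((2 * d) ^ ((d : ℝ) + α) * (2 * max 1 r₀) ^ α / c) := by
  have hα0 : 0 < α := alpha_pos hd J hc hJ
  have hd0 : (0 : ℝ) < d := by exact_mod_cast hd
  have hθ0 : 0 ≤ θ := by
    rw [hθ]
    refine div_nonneg ?_ (by positivity)
    linarith
  have hθ2 : 2 * θ = 1 / 2 - 2 * α / d := by
    rw [hθ]
    field_simp
    ring
  have hθ1 : θ ≤ 1 / 2 := by
    have : 0 < 2 * α / d := by positivity
    linarith
  set C := 48 * Real.exp 4 * (∑' z, J z + 1 / β) with hC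
  have hC0 : 0 ≤ C := by
    have htsum : 0 ≤ ∑' z, J z := tsum_nonneg J.nonneg
    positivity
  -- The side length `r ≍ n ^ (2 / d)` balances `A r ^ (-d θ)` against `r ^ α n ^ (-1 / 2)`; the
  -- factor `ρ` makes all displacements exceed `r₀`.
  set ρ := max 1 r₀ with hρ
  have hρ1 : 1 ≤ ρ := le_max_left _ _
  have hn1 : (1 : ℝ) ≤ n := by exact_mod_cast hn
  have hn0 : (0 : ℝ) < n := by linarith
  set X := (n : ℝ) ^ (2 / (d : ℝ)) with hX
  have hX1 : 1 ≤ X := Real.one_le_rpow hn1 (by positivity)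
  have hρX : 1 ≤ ρ * X := one_le_mul_of_one_le_of_one_le hρ1 hX1
  set r := ⌈ρ * X⌉₊ with hr
  have hr1 : ρ * X ≤ r := Nat.le_ceil _
  have hr2 : (r : ℝ) ≤ 2 * ρ * X := by
    have := Nat.ceil_lt_add_one (show 0 ≤ ρ * X by positivity)
    rw [← hr] at this
    linarith
  have hr0 : (0 : ℝ) < r := by linarith
  have hrX : X ≤ r := (le_mul_of_one_le_left (by positivity) hρ1).trans hr1
  have hrr : r₀ ≤ r := (le_max_right 1 r₀).trans
    ((le_mul_of_one_le_right (by positivity) hX1).trans hr1)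
  set j := c * (2 * d * r : ℝ) ^ (-(d : ℝ) - α) with hj
  have hj0 : 0 < j := by positivity
  have hJj : ∀ z ∈ orthantBox d r, j ≤ J z := fun z hz => by
    have e1 := le_l1norm_of_mem_orthantBox hd hz
    have e2 := l1norm_le_of_mem_orthantBox hz
    refine le_trans (mul_le_mul_of_nonneg_left ?_ hc.le) (hJ z (hrr.trans e1))
    exact Real.rpow_le_rpow_of_nonpos (by linarith) e2 (by linarith)
  obtain ⟨Λ, hΛ⟩ := card_mul_volumeTail_sq_le hd J hβ hn R (Z := orthantBox d r)
    (fun z hz i => lt_of_le_of_lt (Int.natCast_nonneg r) (mem_orthantBox.1 hz i).1) hj0 hJj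
  set t := volumeTail J β (box d R) n 0
  rw [card_orthantBox] at hΛ
  have h1 : ∑ z ∈ orthantBox d r, volumeConn J β Λ 0 z ≤ 2 * A * ((r ^ d : ℕ) : ℝ) ^ (1 - θ) := by
    refine (sum_volumeConn_le J hβ.le Λ _).trans ?_
    rw [card_orthantBox]
    calc ∑ k ∈ Finset.range (r ^ d), volumeTail J β Λ (k + 1) 0
        ≤ ∑ k ∈ Finset.range (r ^ d), A * ((k + 1 : ℕ) : ℝ) ^ (-θ) :=
          Finset.sum_le_sum fun k _ => hA Λ (k + 1) (by omega)
      _ ≤ A * (2 * ((r ^ d : ℕ) : ℝ) ^ (1 - θ)) := by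
          rw [← Finset.mul_sum]
          exact mul_le_mul_of_nonneg_left (sum_rpow_neg_le hθ0 hθ1 _) hA0
      _ = _ := by ring
  set s : ℝ := ((r ^ d : ℕ) : ℝ) with hs
  have hs' : s = (r : ℝ) ^ d := by rw [hs]; push_cast; ring
  have hs0 : 0 < s := by rw [hs']; positivity
  have h2 : s * t ^ 2 ≤ s * (2 * A * s ^ (-θ) + 2 ^ d * C / (s * (j * Real.sqrt n))) := by
    refine hΛ.trans ((add_le_add h1 le_rfl).trans (le_of_eq ?_))
    rw [sub_eq_add_neg, Real.rpow_add hs0, Real.rpow_one, ← hC]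
    field_simp
  have h3 := le_of_mul_le_mul_left h2 hs0
  have h4 : s ^ (-θ) ≤ (n : ℝ) ^ (-(2 * θ)) := by
    have e1 : (n : ℝ) ^ (2 : ℝ) ≤ s := by
      have e2 : X ^ (d : ℝ) = (n : ℝ) ^ (2 : ℝ) := by
        rw [hX, ← Real.rpow_mul hn0.le]
        congr 1
        field_simp
      rw [← e2, hs', ← Real.rpow_natCast]
      exact Real.rpow_le_rpow (by linarith) hrX hd0.le
    have e3 := Real.rpow_le_rpow_of_nonpos (by positivity) e1 (show -θ ≤ 0 by linarith)
    rwa [← Real.rpow_mul hn0.le, show (2 : ℝ) * -θ = -(2 * θ) by ring] at e3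
  have h5 : 1 / (s * (j * Real.sqrt n)) ≤
      ((2 * d) ^ ((d : ℝ) + α) * (2 * ρ) ^ α / c) * (n : ℝ) ^ (-(2 * θ)) := by
    have e1 : 1 / (s * (j * Real.sqrt n)) =
        (2 * d) ^ ((d : ℝ) + α) / c * (r : ℝ) ^ α * (n : ℝ) ^ (-(1 / 2 : ℝ)) := by
      rw [hs', hj, Real.sqrt_eq_rpow, Real.mul_rpow (by positivity) hr0.le,
        show -(d : ℝ) - α = -((d : ℝ) + α) by ring, Real.rpow_neg (by positivity),
        Real.rpow_neg hr0.le, Real.rpow_neg hn0.le, Real.rpow_add hr0, Real.rpow_natCast]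
      field_simp
    have e2 : (r : ℝ) ^ α ≤ (2 * ρ) ^ α * (n : ℝ) ^ (2 * α / d) := by
      have := Real.rpow_le_rpow hr0.le hr2 hα0.le
      rwa [Real.mul_rpow (by positivity) (by positivity), hX, ← Real.rpow_mul hn0.le,
        show 2 / (d : ℝ) * α = 2 * α / d by ring] at this
    have e3 : (n : ℝ) ^ (-(2 * θ)) = (n : ℝ) ^ (2 * α / d) * (n : ℝ) ^ (-(1 / 2 : ℝ)) := by
      rw [← Real.rpow_add hn0, hθ2]
      congr 1
      ring
    rw [e1, e3]
    calc (2 * d) ^ ((d : ℝ) + α) / c * (r : ℝ) ^ α * (n : ℝ) ^ (-(1 / 2 : ℝ))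
        ≤ (2 * d) ^ ((d : ℝ) + α) / c * ((2 * ρ) ^ α * (n : ℝ) ^ (2 * α / d)) *
          (n : ℝ) ^ (-(1 / 2 : ℝ)) := by gcongr
      _ = _ := by ring
  set κ := (2 * d) ^ ((d : ℝ) + α) * (2 * ρ) ^ α / c
  have h6 : t ^ 2 ≤ (2 * A + 2 ^ d * C * κ) * (n : ℝ) ^ (-(2 * θ)) := by
    have e1 := mul_le_mul_of_nonneg_left h4 (show 0 ≤ 2 * A by positivity)
    have e2 := mul_le_mul_of_nonneg_left h5 (show 0 ≤ 2 ^ d * C by positivity)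
    rw [mul_one_div] at e2
    linarith
  have h7 : ((n : ℝ) ^ θ) ^ 2 * (n : ℝ) ^ (-(2 * θ)) = 1 := by
    rw [← Real.rpow_natCast, ← Real.rpow_mul hn0.le, ← Real.rpow_add hn0]
    have : θ * ((2 : ℕ) : ℝ) + -(2 * θ) = 0 := by push_cast; ring
    rw [this, Real.rpow_zero]
  have h8 := mul_le_mul_of_nonneg_left h6 (sq_nonneg ((n : ℝ) ^ θ))
  rw [mul_pow]
  refine h8.trans (le_of_eq ?_)
  rw [mul_left_comm, h7, mul_one]

/-- The bootstrap: an a priori bound with some constant self-improves to a bound with an explicit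
constant. -/
theorem volumeTail_le_of_bounded (hd : 1 ≤ d) (J : Intensity d) {α c r₀ : ℝ}
    (hα : α < (d : ℝ) / 4) (hc : 0 < c)
    (hJ : ∀ x : Lattice d, r₀ ≤ l1norm x → c * l1norm x ^ (-(d : ℝ) - α) ≤ J x)
    {θ : ℝ} (hθ : θ = ((d : ℝ) - 4 * α) / (4 * (d : ℝ))) {β : ℝ} (hβ : 0 < β)
    (hbdd : ∃ A₀ : ℝ, ∀ (Λ : Finset (Lattice d)) (k : ℕ), 1 ≤ k →
      volumeTail J β Λ k 0 ≤ A₀ * (k : ℝ) ^ (-θ)) (Λ : Finset (Lattice d)) {n : ℕ} (hn : 1 ≤ n) :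
    volumeTail J β Λ n 0 ≤ (2 + 2 ^ d * (48 * Real.exp 4 * (∑' z, J z + 1 / β)) *
        ((2 * d) ^ ((d : ℝ) + α) * (2 * max 1 r₀) ^ α / c)) * (n : ℝ) ^ (-θ) := by
  set K := 2 ^ d * (48 * Real.exp 4 * (∑' z, J z + 1 / β)) *
        ((2 * d) ^ ((d : ℝ) + α) * (2 * max 1 r₀) ^ α / c) with hK
  have hK0 : 0 ≤ K := by
    have htsum : 0 ≤ ∑' z, J z := tsum_nonneg J.nonneg
    positivity
  obtain ⟨A₀, hA₀⟩ := hbdd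
  have hinv : ∀ {m : ℕ}, 1 ≤ m → (m : ℝ) ^ θ * (m : ℝ) ^ (-θ) = 1 := fun {m} hm => by
    have : (0 : ℝ) < m := by exact_mod_cast hm
    rw [← Real.rpow_add this, add_neg_cancel, Real.rpow_zero]
  let 𝒮 : Set ℝ := {s | ∃ R m : ℕ, 1 ≤ m ∧ s = (m : ℝ) ^ θ * volumeTail J β (box d R) m 0}
  have hb : BddAbove 𝒮 := by
    refine ⟨A₀, ?_⟩
    rintro s ⟨R, m, hm, rfl⟩
    calc (m : ℝ) ^ θ * volumeTail J β (box d R) m 0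
        ≤ (m : ℝ) ^ θ * (A₀ * (m : ℝ) ^ (-θ)) :=
          mul_le_mul_of_nonneg_left (hA₀ _ m hm) (by positivity)
      _ = A₀ := by rw [mul_left_comm, hinv hm, mul_one]
  have hne : 𝒮.Nonempty := ⟨_, 0, 1, le_rfl, rfl⟩
  set A := sSup 𝒮 with hA
  have hA0 : 0 ≤ A := by
    refine le_csSup_of_le hb ⟨0, 1, le_rfl, rfl⟩ ?_
    exact mul_nonneg (by positivity) (volumeTail_nonneg J hβ.le _ _ _)
  have hAbound : ∀ (Λ : Finset (Lattice d)) (k : ℕ), 1 ≤ k →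
      volumeTail J β Λ k 0 ≤ A * (k : ℝ) ^ (-θ) := by
    intro Λ k hk
    obtain ⟨R, hR⟩ := exists_subset_box Λ
    refine (volumeTail_mono J hβ.le hR k 0).trans ?_
    have h1 : (k : ℝ) ^ θ * volumeTail J β (box d R) k 0 ≤ A := le_csSup hb ⟨R, k, hk, rfl⟩
    have h2 := mul_le_mul_of_nonneg_right h1 (show (0 : ℝ) ≤ (k : ℝ) ^ (-θ) by positivity)
    rwa [mul_right_comm, hinv hk, one_mul] at h2
  have hsq : A ≤ Real.sqrt (2 * A + K) := by
    refine csSup_le hne ?_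
    rintro s ⟨R, m, hm, rfl⟩
    exact Real.le_sqrt_of_sq_le (volumeTail_sq_le hd J hα hc hJ hθ hβ hA0 hAbound R hm)
  have hA2 : A ^ 2 ≤ 2 * A + K := (Real.le_sqrt hA0 (by positivity)).1 hsq
  have hA3 : A ≤ 2 + K := by
    by_contra h
    push Not at h
    nlinarith
  exact (hAbound Λ n hn).trans (mul_le_mul_of_nonneg_right hA3 (by positivity))

/-- If some boundary flow from the origin is at most `1 / 2`, uniformly over the outer volume, then
the a priori bound of the bootstrap holds. -/
theorem volumeTail_le_of_boundaryFlow (J : Intensity d) {β θ : ℝ} (hβ : 0 ≤ β) (hθ : θ ≤ 1)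
    {S : Finset (Lattice d)} (h0 : 0 ∈ S) (hS : ∀ T : Finset (Lattice d), Disjoint S T →
      boundaryFlow (bondProb (edgeWeight J) β) 0 S T ≤ 1 / 2)
    (Λ : Finset (Lattice d)) {k : ℕ} (hk : 1 ≤ k) :
    volumeTail J β Λ k 0 ≤ 2 * S.card * (k : ℝ) ^ (-θ) := by
  set p := bondProb (edgeWeight J) β with hp
  have hp01 : ∀ e, 0 ≤ p e ∧ p e ≤ 1 := bondProb_edgeWeight_mem J hβ
  set Λ' := insert 0 Λ with hΛ'
  have h1 : ∀ u ∈ Λ', ∃ S' ⊆ Λ', u ∈ S' ∧ (S'.card : ℝ) ≤ S.card ∧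
      boundaryFlow p u S' (Λ' \ S') ≤ 1 / 2 := by
    intro u hu
    set Su := S.image (Equiv.addRight u) with hSu
    refine ⟨Su ∩ Λ', Finset.inter_subset_right, Finset.mem_inter.2
      ⟨Finset.mem_image.2 ⟨0, h0, by simp⟩, hu⟩, ?_, ?_⟩
    · exact_mod_cast (Finset.card_le_card Finset.inter_subset_left).trans Finset.card_image_le
    · set T := (Λ' \ (Su ∩ Λ')).image (Equiv.addRight (-u)) with hT
      have hdisj : Disjoint S T := Finset.disjoint_left.2 fun x hx hxT => by
        obtain ⟨y, hy, rfl⟩ := Finset.mem_image.1 hxT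
        obtain ⟨hy1, hy2⟩ := Finset.mem_sdiff.1 hy
        refine hy2 (Finset.mem_inter.2 ⟨Finset.mem_image.2 ⟨_, hx, by simp⟩, hy1⟩)
      refine le_trans ?_ (hS T hdisj)
      rw [boundaryFlow, boundaryFlow]
      calc ∑ x ∈ Su ∩ Λ', ∑ y ∈ Λ' \ (Su ∩ Λ'),
            expect p (Su ∩ Λ').sym2 (fun F => connInd F u x) * p s(x, y)
          ≤ ∑ x ∈ Su ∩ Λ', ∑ y ∈ Λ' \ (Su ∩ Λ'),
            expect p Su.sym2 (fun F => connInd F u x) * p s(x, y) :=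
            Finset.sum_le_sum fun x _ => Finset.sum_le_sum fun y _ =>
              mul_le_mul_of_nonneg_right (expect_le_of_subset
                (Finset.sym2_mono Finset.inter_subset_left) (fun e _ => hp01 e)
                (connInd_mono u x)) (hp01 _).1
        _ ≤ ∑ x ∈ Su, ∑ y ∈ Λ' \ (Su ∩ Λ'),
            expect p Su.sym2 (fun F => connInd F u x) * p s(x, y) :=
            Finset.sum_le_sum_of_subset_of_nonneg Finset.inter_subset_left fun x _ _ =>
              Finset.sum_nonneg fun y _ => mul_nonneg
                (expect_nonneg (fun e _ => hp01 e) fun F _ => connInd_nonneg F _ _) (hp01 _).1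
        _ = _ := by
            rw [hSu, Finset.sum_image fun a _ b _ h => (Equiv.addRight u).injective h]
            refine Finset.sum_congr rfl fun x _ => ?_
            rw [hT, Finset.sum_image fun a _ b _ h => (Equiv.addRight (-u)).injective h]
            refine Finset.sum_congr rfl fun y _ => ?_
            have e1 := volumeConn_translate J β S 0 x u
            rw [zero_add] at e1
            have e2 : p s(x + u, y) = p s(x, y + -u) := by
              simp only [hp, bondProb, edgeWeight_mk]
              congr 5
              abel
            exact congrArg₂ (· * ·) e1 e2
  have h2 := expect_clusterSize_le hp01 h1 (Finset.mem_insert_self 0 Λ)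
  have hk0 : (0 : ℝ) < k := by exact_mod_cast hk
  have h3 : volumeTail J β Λ' k 0 * k ≤ expect p Λ'.sym2 (fun F => (clusterSize F 0 : ℝ)) := by
    rw [volumeTail, ← expect_mul_const]
    refine expect_le_expect (fun e _ => hp01 e) fun F _ => ?_
    unfold atLeast
    split_ifs with h
    · rw [one_mul]; exact_mod_cast h
    · simp
  have h4 : volumeTail J β Λ' k 0 ≤ 2 * S.card * (k : ℝ) ^ (-1 : ℝ) := by
    rw [Real.rpow_neg_one, ← div_eq_mul_inv, le_div_iff₀ hk0]
    exact h3.trans h2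
  refine (volumeTail_mono J hβ (Finset.subset_insert 0 Λ) k 0).trans (h4.trans ?_)
  refine mul_le_mul_of_nonneg_left ?_ (by positivity)
  exact Real.rpow_le_rpow_of_exponent_le (by exact_mod_cast hk) (by linarith)

end Bootstrap

/-! ### From finite volumes to the lattice -/

section Transfer

variable {d : ℕ}

instance (J : Intensity d) (β : ℝ≥0) : IsProbabilityMeasure (percolation J β) := by
  unfold percolation
  infer_instance

/-- The open pairs in `E`. -/
noncomputable def openEdges (ω : Config d) (E : Finset (Sym2 (Lattice d))) :
    Finset (Sym2 (Lattice d)) :=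
  E.filter fun e => ω e = true

lemma openEdges_eq_iff {ω : Config d} {E F : Finset (Sym2 (Lattice d))} (hF : F ⊆ E) :
    openEdges ω E = F ↔ ∀ e ∈ E, ω e = decide (e ∈ F) := by
  constructor
  · rintro rfl e he
    simp [openEdges, he]
  · intro h
    ext e
    simp only [openEdges, Finset.mem_filter]
    constructor
    · rintro ⟨he, hω⟩
      rw [h e he] at hω
      exact of_decide_eq_true hω
    · intro he
      exact ⟨hF he, by rw [h e (hF he)]; exact decide_eq_true he⟩

lemma percolation_openEdges_eq (J : Intensity d) (β : ℝ≥0) {E F : Finset (Sym2 (Lattice d))}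
    (hF : F ⊆ E) :
    MeasurableSet {ω : Config d | openEdges ω E = F} ∧
    (percolation J β).real {ω | openEdges ω E = F} =
      bernoulliWeight (bondProb (edgeWeight J) β) E F := by
  have h1 : {ω : Config d | openEdges ω E = F} =
      Set.pi (E : Set (Sym2 (Lattice d))) fun e => {decide (e ∈ F)} := by
    ext ω
    simp only [Set.mem_ofPred_eq, openEdges_eq_iff hF, Set.mem_pi, Finset.mem_coe,
      Set.mem_singleton_iff]
  rw [h1]
  refine ⟨MeasurableSet.pi (Finset.countable_toSet E) fun e _ => measurableSet_singleton _, ?_⟩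
  rw [measureReal_def, percolation, Measure.infinitePi_pi _ fun e _ => measurableSet_singleton _,
    ENNReal.toReal_prod, bernoulliWeight]
  refine Finset.prod_congr rfl fun e _ => ?_
  rw [← measureReal_def, bernoulliMeasure_real_apply _ (measurableSet_singleton _)]
  by_cases he : e ∈ F
  · simp [he, inclusionProb, bondProb]
  · simp [he, inclusionProb, bondProb]

/-- The law of the open pairs in a finite set. -/
lemma percolation_real_openEdges (J : Intensity d) (β : ℝ≥0) (E : Finset (Sym2 (Lattice d)))
    (P : Finset (Sym2 (Lattice d)) → Prop) [DecidablePred P] :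
    (percolation J β).real {ω | P (openEdges ω E)} =
      expect (bondProb (edgeWeight J) β) E (fun F => if P F then 1 else 0) := by
  have h1 : {ω : Config d | P (openEdges ω E)} =
      ⋃ F ∈ E.powerset.filter P, {ω | openEdges ω E = F} := by
    ext ω
    simp only [Set.mem_ofPred_eq, Set.mem_iUnion, Finset.mem_filter, Finset.mem_powerset,
      exists_prop, exists_eq_right']
    exact ⟨fun h => ⟨Finset.filter_subset _ _, h⟩, fun h => h.2⟩
  have hsub : ∀ F ∈ E.powerset.filter P, F ⊆ E := fun F hF =>
    Finset.mem_powerset.1 (Finset.mem_filter.1 hF).1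
  rw [h1, measureReal_biUnion_finset]
  · rw [expect]
    simp only [mul_ite, mul_one, mul_zero]
    rw [← Finset.sum_filter]
    exact Finset.sum_congr rfl fun F hF => (percolation_openEdges_eq J β (hsub F hF)).2
  · intro F _ F' _ hne
    refine Set.disjoint_left.2 fun ω h h' => hne ?_
    exact Eq.trans (Eq.symm h) h'
  · exact fun F hF => (percolation_openEdges_eq J β (hsub F hF)).1

lemma openEdges_mono (ω : Config d) {E E' : Finset (Sym2 (Lattice d))} (h : E ⊆ E') :
    openEdges ω E ⊆ openEdges ω E' := Finset.filter_subset_filter _ h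

lemma bondGraph_openEdges_le (ω : Config d) (E : Finset (Sym2 (Lattice d))) :
    bondGraph (openEdges ω E) ≤ openGraph ω :=
  SimpleGraph.fromEdgeSet_mono fun _ he => (Finset.mem_filter.1 he).2

lemma reachable_openGraph_iff {ω : Config d} {x y : Lattice d} :
    (openGraph ω).Reachable x y ↔
      ∃ N, (bondGraph (openEdges ω (box d N).sym2)).Reachable x y := by
  constructor
  · intro h
    rw [SimpleGraph.reachable_iff_reflTransGen] at h
    induction h with
    | refl => exact ⟨0, SimpleGraph.Reachable.refl _⟩
    | @tail b c _ hbc ih =>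
      obtain ⟨N, hN⟩ := ih
      obtain ⟨M, hM⟩ := exists_subset_box {b, c}
      have hb : b ∈ box d M := hM (by simp)
      have hc : c ∈ box d M := hM (by simp)
      refine ⟨max N M, (reachable_mono (openEdges_mono ω
        (Finset.sym2_mono (box_mono (le_max_left N M)))) hN).trans (reachable_of_mem ?_)⟩
      refine Finset.mem_filter.2 ⟨Finset.mk_mem_sym2_iff.2 ⟨box_mono (le_max_right N M) hb,
        box_mono (le_max_right N M) hc⟩, ?_⟩
      exact ((SimpleGraph.fromEdgeSet_adj _).1 hbc).1
  · rintro ⟨N, hN⟩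
    exact hN.mono (bondGraph_openEdges_le ω _)

lemma le_encard_cluster_iff {ω : Config d} {x : Lattice d} {n : ℕ} :
    (n : ℕ∞) ≤ (cluster ω x).encard ↔
      ∃ N, n ≤ clusterSize (openEdges ω (box d N).sym2) x := by
  constructor
  · intro h
    obtain ⟨t, ht, htn⟩ := Set.exists_subset_encard_eq h
    have hfin : t.Finite := Set.finite_of_encard_eq_coe htn
    choose! f hf using fun y (hy : y ∈ t) => reachable_openGraph_iff.1 (ht hy)
    refine ⟨hfin.toFinset.sup f, ?_⟩
    have h1 : hfin.toFinset ⊆ clusterOf (openEdges ω (box d (hfin.toFinset.sup f)).sym2) {x} := by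
      intro y hy
      refine mem_clusterOf_singleton.2 (reachable_mono (openEdges_mono ω (Finset.sym2_mono
        (box_mono (Finset.le_sup hy)))) (hf y (hfin.mem_toFinset.1 hy)))
    have h2 := Finset.card_le_card h1
    rw [hfin.encard_eq_coe_toFinset_card] at htn
    have h3 : hfin.toFinset.card = n := by exact_mod_cast htn
    rwa [h3] at h2
  · rintro ⟨N, hN⟩
    have h1 : (clusterOf (openEdges ω (box d N).sym2) {x} : Set (Lattice d)) ⊆ cluster ω x :=
      fun y hy => reachable_openGraph_iff.2 ⟨N, mem_clusterOf_singleton.1 hy⟩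
    calc (n : ℕ∞) ≤ ((clusterOf (openEdges ω (box d N).sym2) {x}).card : ℕ∞) := by
          exact_mod_cast hN
      _ = (clusterOf (openEdges ω (box d N).sym2) {x} : Set (Lattice d)).encard :=
          (Set.encard_coe_eq_coe_finsetCard _).symm
      _ ≤ _ := Set.encard_le_encard h1

lemma percolation_real_le_of_volumeTail_le (J : Intensity d) (β : ℝ≥0) {n : ℕ} {x : Lattice d}
    {b : ℝ} (h : ∀ Λ, volumeTail J β Λ n x ≤ b) :
    (percolation J β).real {ω | (n : ℕ∞) ≤ (cluster ω x).encard} ≤ b := by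
  have hb : 0 ≤ b := (volumeTail_nonneg J β.coe_nonneg ∅ n x).trans (h ∅)
  have h1 : {ω : Config d | (n : ℕ∞) ≤ (cluster ω x).encard} =
      ⋃ N, {ω | n ≤ clusterSize (openEdges ω (box d N).sym2) x} := by
    ext ω
    simp only [Set.mem_ofPred_eq, le_encard_cluster_iff, Set.mem_iUnion]
  have hmono : Monotone fun N => {ω : Config d | n ≤ clusterSize (openEdges ω (box d N).sym2) x} :=
    fun N M hNM ω hω => le_trans hω
      (clusterSize_mono x (openEdges_mono ω (Finset.sym2_mono (box_mono hNM))))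
  rw [measureReal_def, h1, hmono.measure_iUnion]
  refine ENNReal.toReal_le_of_le_ofReal hb (iSup_le fun N => ?_)
  rw [← ofReal_measureReal (measure_ne_top _ _)]
  refine ENNReal.ofReal_le_ofReal ?_
  rw [percolation_real_openEdges J β (box d N).sym2 fun F => n ≤ clusterSize F x]
  exact h (box d N)

/-- If there is no infinite cluster at `β₂`, then at any `β₁ < β₂` some boundary flow is small. -/
theorem exists_boundaryFlow_le (J : Intensity d) {β₁ β₂ : ℝ≥0} (h12 : β₁ < β₂)
    (hno : NoInfiniteCluster J β₂) :
    ∃ S : Finset (Lattice d), 0 ∈ S ∧ ∀ T : Finset (Lattice d), Disjoint S T →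
      boundaryFlow (bondProb (edgeWeight J) β₁) 0 S T ≤ 1 / 2 := by
  by_contra hcon
  push Not at hcon
  choose! T hT using hcon
  set δ := 1 - Real.exp (-(((β₂ : ℝ) - β₁) / (2 * β₂))) with hδ
  have h12' : (β₁ : ℝ) < β₂ := by exact_mod_cast h12
  have hβ₂ : (0 : ℝ) < β₂ := β₁.coe_nonneg.trans_lt h12'
  have hδ0 : 0 < δ := by
    have : Real.exp (-(((β₂ : ℝ) - β₁) / (2 * β₂))) < 1 :=
      Real.exp_lt_one_iff.2 (neg_lt_zero.2 (div_pos (by linarith) (by positivity)))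
    linarith
  have hN : ∀ N, (percolation J β₂).real {ω | cluster ω 0 ⊆ box d N} ≤ 1 - δ := by
    intro N
    -- A finite volume large enough that every `S` inside the box has boundary flow at least `1 / 2`.
    set Λ := box d N ∪ (box d N).powerset.biUnion T with hΛ
    have h1 : ∀ S ⊆ box d N, 0 ∈ S →
        1 / 2 ≤ boundaryFlow (bondProb (edgeWeight J) β₁) 0 S (Λ \ S) := by
      intro S hS h0
      obtain ⟨hd, hf⟩ := hT S h0
      refine hf.le.trans (boundaryFlow_mono_right (bondProb_edgeWeight_mem J β₁.coe_nonneg) 0 S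
        fun y hy => Finset.mem_sdiff.2 ⟨Finset.mem_union_right _ (Finset.mem_biUnion.2
          ⟨S, Finset.mem_powerset.2 hS, hy⟩), Finset.disjoint_right.1 hd hy⟩)
    have h2 := le_expect_hitInd (edgeWeight_nonneg J) (zero_mem_box N) Finset.subset_union_left
      β₁.coe_nonneg h12' h1
    have h3 : {ω : Config d | cluster ω 0 ⊆ box d N} ⊆
        {ω | 0 ∉ clusterOf (openEdges ω Λ.sym2) (Λ \ box d N)} := by
      intro ω hω hmem
      obtain ⟨y, hy, hy0⟩ := mem_clusterOf.1 hmem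
      have hyc : y ∈ cluster ω 0 := (hy0.mono (bondGraph_openEdges_le ω _)).symm
      exact (Finset.mem_sdiff.1 hy).2 (hω hyc)
    refine (measureReal_mono h3).trans ?_
    rw [percolation_real_openEdges J β₂ Λ.sym2 fun F => 0 ∉ clusterOf F (Λ \ box d N)]
    have h4 : expect (bondProb (edgeWeight J) β₂) Λ.sym2
        (fun F => if 0 ∉ clusterOf F (Λ \ box d N) then 1 else 0) =
        1 - expect (bondProb (edgeWeight J) β₂) Λ.sym2 (hitInd 0 (Λ \ box d N)) := by
      rw [expect_congr_fun (g := fun F => 1 - hitInd 0 (Λ \ box d N) F), expect_sub, expect_const]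
      intro F _
      unfold hitInd
      by_cases hF : 0 ∈ clusterOf F (Λ \ box d N) <;> simp [hF]
    rw [h4]
    linarith
  have hmono : Monotone fun N => {ω : Config d | cluster ω 0 ⊆ box d N} :=
    fun N M hNM ω hω => Set.Subset.trans hω (Finset.coe_subset.2 (box_mono hNM))
  have hfull : (percolation J β₂) (⋃ N, {ω : Config d | cluster ω 0 ⊆ box d N}) = 1 := by
    have hae : (⋃ N, {ω : Config d | cluster ω 0 ⊆ box d N}) ∈ ae (percolation J β₂) := by
      filter_upwards [hno] with ω hω
      obtain ⟨N, hN⟩ := exists_subset_box (hω 0).toFinset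
      exact Set.mem_iUnion.2 ⟨N, fun y hy => hN ((hω 0).mem_toFinset.2 hy)⟩
    rw [measure_congr (Filter.eventuallyEq_univ.2 hae), measure_univ]
  rw [hmono.measure_iUnion] at hfull
  have h5 : (⨆ N, (percolation J β₂) {ω : Config d | cluster ω 0 ⊆ box d N}) ≤
      ENNReal.ofReal (1 - δ) := iSup_le fun N => by
    rw [← ofReal_measureReal (measure_ne_top _ _)]
    exact ENNReal.ofReal_le_ofReal (hN N)
  rw [hfull, ENNReal.one_le_ofReal] at h5
  linarith

end Transfer

/-! ### The critical parameter -/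

section Critical

variable {d : ℕ}

lemma volumeTail_le_at (J : Intensity d) {β : ℝ} {n : ℕ} {b : ℝ}
    (h : ∀ Λ, volumeTail J β Λ n 0 ≤ b) (Λ : Finset (Lattice d)) (x : Lattice d) :
    volumeTail J β Λ n x ≤ b := by
  have h1 := volumeTail_translate J β Λ n x (-x)
  rw [add_neg_cancel] at h1
  rw [← h1]
  exact h _

lemma continuous_volumeTail (J : Intensity d) (Λ : Finset (Lattice d)) (n : ℕ) (x : Lattice d) :
    Continuous fun β => volumeTail J β Λ n x :=
  continuous_iff_continuousAt.2 fun b =>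
    (hasDerivAt_expect (fun e _ => hasDerivAt_bondProb (edgeWeight J) b e) _).continuousAt

lemma volumeTail_zero (J : Intensity d) (Λ : Finset (Lattice d)) (n : ℕ) :
    volumeTail J 0 Λ n 0 ≤ atLeast n 1 := by
  have h : ∀ (E : Finset (Sym2 (Lattice d))) (f : Finset (Sym2 (Lattice d)) → ℝ),
      expect (bondProb (edgeWeight J) 0) E f = f ∅ := by
    intro E f
    induction E using Finset.induction_on generalizing f with
    | empty => exact expect_empty _ _
    | insert e E he ih => rw [expect_insert _ he, ih, ih]; simp [bondProb]
  rw [volumeTail, h]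
  have h1 : clusterOf (∅ : Finset (Sym2 (Lattice d))) {0} ⊆ {0} := by
    refine clusterOf_subset ?_ subset_rfl
    simp
  exact atLeast_mono n ((Finset.card_le_card h1).trans (by simp))

/-- As `β → ∞`, the origin is connected to any finite set of points `z` with `J z > 0`. -/
lemma exists_volumeTail_gt (J : Intensity d) {Z : Finset (Lattice d)} (hZ : ∀ z ∈ Z, 0 < J z)
    {n : ℕ} (hn : n ≤ Z.card) {b : ℝ} (hb : b < 1) :
    ∃ β : ℝ≥0, ∃ Λ : Finset (Lattice d), b < volumeTail J β Λ n 0 := by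
  set E₀ := Z.image fun z => s((0 : Lattice d), z) with hE₀
  have hpos : ∀ e ∈ E₀, 0 < edgeWeight J e := by
    intro e he
    obtain ⟨z, hz, rfl⟩ := Finset.mem_image.1 he
    rw [edgeWeight_mk, sub_zero]
    exact hZ z hz
  have hlim : Filter.Tendsto (fun β : ℝ => ∏ e ∈ E₀, bondProb (edgeWeight J) β e) Filter.atTop
      (nhds 1) := by
    have h1 : ∀ e ∈ E₀, Filter.Tendsto (fun β : ℝ => bondProb (edgeWeight J) β e) Filter.atTop
        (nhds 1) := by
      intro e he
      have h2 : Filter.Tendsto (fun β : ℝ => Real.exp (-(β * edgeWeight J e))) Filter.atTop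
          (nhds 0) := Real.tendsto_exp_neg_atTop_nhds_zero.comp
            (Filter.tendsto_id.atTop_mul_const (hpos e he))
      simpa [bondProb] using h2.const_sub 1
    simpa using tendsto_finsetProd E₀ h1
  obtain ⟨β, hβb, hβ0⟩ := ((hlim.eventually (lt_mem_nhds hb)).and
    (Filter.eventually_ge_atTop (0 : ℝ))).exists
  refine ⟨⟨β, hβ0⟩, insert 0 Z, hβb.trans_le ?_⟩
  set p := bondProb (edgeWeight J) β
  have hsub : E₀ ⊆ (insert 0 Z).sym2 := by
    intro e he
    obtain ⟨z, hz, rfl⟩ := Finset.mem_image.1 he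
    exact Finset.mk_mem_sym2_iff.2 ⟨Finset.mem_insert_self _ _, Finset.mem_insert_of_mem hz⟩
  have hp : ∀ e, 0 ≤ p e ∧ p e ≤ 1 := bondProb_edgeWeight_mem J hβ0
  refine le_trans ?_ (expect_le_of_subset hsub (fun e _ => hp e)
    fun _ _ h => atLeast_mono n (clusterSize_mono (0 : Lattice d) h))
  have h1 : atLeast n (clusterSize E₀ (0 : Lattice d)) = 1 := by
    refine if_pos (hn.trans (Finset.card_le_card fun z hz => ?_))
    exact mem_clusterOf_singleton.2 (reachable_of_mem (Finset.mem_image.2 ⟨z, hz, rfl⟩))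
  calc ∏ e ∈ E₀, p e = bernoulliWeight p E₀ E₀ * atLeast n (clusterSize E₀ (0 : Lattice d)) := by
        rw [h1, mul_one, bernoulliWeight]
        exact Finset.prod_congr rfl fun e he => (if_pos he).symm
    _ ≤ _ := Finset.single_le_sum (f := fun F => bernoulliWeight p E₀ F *
        atLeast n (clusterSize F (0 : Lattice d)))
        (fun F _ => mul_nonneg (bernoulliWeight_nonneg (fun e _ => hp e) F) (atLeast_nonneg _ _))
        (Finset.mem_powerset_self E₀)

lemma volumeTail_le_of_lt_critical (hd : 1 ≤ d) (J : Intensity d) {α c r₀ : ℝ}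
    (hα : α < (d : ℝ) / 4) (hc : 0 < c)
    (hJ : ∀ x : Lattice d, r₀ ≤ l1norm x → c * l1norm x ^ (-(d : ℝ) - α) ≤ J x)
    {θ : ℝ} (hθ : θ = ((d : ℝ) - 4 * α) / (4 * (d : ℝ))) {β : ℝ≥0} (hβ : 0 < β)
    (hβc : (β : ℝ≥0∞) < criticalParameter J) (Λ : Finset (Lattice d)) {n : ℕ} (hn : 1 ≤ n) :
    volumeTail J β Λ n 0 ≤ (2 + 2 ^ d * (48 * Real.exp 4 * (∑' z, J z + 1 / β)) *
        ((2 * d) ^ ((d : ℝ) + α) * (2 * max 1 r₀) ^ α / c)) * (n : ℝ) ^ (-θ) := by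
  obtain ⟨β', hlt⟩ := lt_iSup_iff.1 hβc
  obtain ⟨hno, hlt⟩ := lt_iSup_iff.1 hlt
  obtain ⟨S, h0, hS⟩ := exists_boundaryFlow_le J (ENNReal.coe_lt_coe.1 hlt) hno
  have hα0 := alpha_pos hd J hc hJ
  have hd0 : (0 : ℝ) < d := by exact_mod_cast hd
  have hθ1 : θ ≤ 1 := by
    rw [hθ, div_le_one (by positivity)]
    linarith
  exact volumeTail_le_of_bounded hd J hα hc hJ hθ (by exact_mod_cast hβ)
    ⟨2 * S.card, fun Λ k hk => volumeTail_le_of_boundaryFlow J β.coe_nonneg hθ1 h0 hS Λ hk⟩ Λ hn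

/-- The bound on the finite-volume tails, uniformly over `β ≤ β_c`. -/
theorem exists_volumeTail_le (hd : 1 ≤ d) (J : Intensity d) {α c r₀ : ℝ}
    (hα : α < (d : ℝ) / 4) (hc : 0 < c)
    (hJ : ∀ x : Lattice d, r₀ ≤ l1norm x → c * l1norm x ^ (-(d : ℝ) - α) ≤ J x)
    {θ : ℝ} (hθ : θ = ((d : ℝ) - 4 * α) / (4 * (d : ℝ))) :
    ∃ C : ℝ, ∀ β : ℝ≥0, (β : ℝ≥0∞) ≤ criticalParameter J → ∀ n : ℕ, 1 ≤ n →
      ∀ (Λ : Finset (Lattice d)) (x : Lattice d),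
        volumeTail J β Λ n x ≤ C * (n : ℝ) ^ (-θ) := by
  suffices h : ∃ C : ℝ, ∀ β : ℝ≥0, (β : ℝ≥0∞) ≤ criticalParameter J → ∀ n : ℕ, 1 ≤ n →
      ∀ Λ : Finset (Lattice d), volumeTail J β Λ n 0 ≤ C * (n : ℝ) ^ (-θ) by
    obtain ⟨C, hC⟩ := h
    exact ⟨C, fun β hβ n hn => volumeTail_le_at J (hC β hβ n hn)⟩
  rcases eq_or_ne (criticalParameter J) 0 with h0 | h0
  · refine ⟨1, fun β hβ n hn Λ => ?_⟩
    rw [h0, nonpos_iff_eq_zero, ENNReal.coe_eq_zero] at hβ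
    subst hβ
    refine (volumeTail_zero J Λ n).trans ?_
    rcases hn.eq_or_lt with rfl | h
    · simp [atLeast]
    · have : ¬n ≤ 1 := by omega
      simp only [atLeast, this, if_false]
      positivity
  obtain ⟨β₀, hβ₀, hβ₀c⟩ := ENNReal.lt_iff_exists_nnreal_btwn.1 (pos_iff_ne_zero.2 h0)
  have hβ₀' : 0 < β₀ := by exact_mod_cast hβ₀
  set K : ℝ := (2 * d) ^ ((d : ℝ) + α) * (2 * max 1 r₀) ^ α / c with hK
  have hK0 : 0 ≤ K := by positivity
  set C : ℝ := 2 + 2 ^ d * (48 * Real.exp 4 * (∑' z, J z + 1 / β₀)) * K with hC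
  have hlt : ∀ β : ℝ≥0, (β : ℝ≥0∞) < criticalParameter J → ∀ n : ℕ, 1 ≤ n →
      ∀ Λ : Finset (Lattice d), volumeTail J β Λ n 0 ≤ C * (n : ℝ) ^ (-θ) := by
    intro β hβ n hn Λ
    have h1 : ((max β β₀ : ℝ≥0) : ℝ≥0∞) < criticalParameter J := by
      rw [ENNReal.coe_max]
      exact max_lt hβ hβ₀c
    have h2 := volumeTail_mono_param J β.coe_nonneg
      (show (β : ℝ) ≤ ((max β β₀ : ℝ≥0) : ℝ) from NNReal.coe_le_coe.2 (le_max_left _ _)) Λ n 0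
    refine h2.trans ((volumeTail_le_of_lt_critical hd J hα hc hJ hθ
      (lt_max_of_lt_right hβ₀') h1 Λ hn).trans ?_)
    have h3 : 1 / ((max β β₀ : ℝ≥0) : ℝ) ≤ 1 / (β₀ : ℝ) :=
      one_div_le_one_div_of_le (by exact_mod_cast hβ₀') (NNReal.coe_le_coe.2 (le_max_right _ _))
    rw [hC]
    gcongr
  refine ⟨C, fun β hβ n hn Λ => ?_⟩
  rcases hβ.lt_or_eq with h | h
  · exact hlt β h n hn Λ
  -- At `β = β_c` the bound follows by left-continuity of the finite-volume probability.
  have hβpos : (0 : ℝ) < β := by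
    have : (0 : ℝ≥0∞) < β := h ▸ pos_iff_ne_zero.2 h0
    exact_mod_cast this
  have htend : Filter.Tendsto (fun t : ℝ => volumeTail J t Λ n 0) (nhdsWithin (β : ℝ)
      (Set.Iio β)) (nhds (volumeTail J β Λ n 0)) :=
    ((continuous_volumeTail J Λ n 0).tendsto _).mono_left nhdsWithin_le_nhds
  refine le_of_tendsto htend ?_
  filter_upwards [Ioo_mem_nhdsLT hβpos] with t ht
  obtain ⟨s, rfl⟩ : ∃ s : ℝ≥0, (s : ℝ) = t := ⟨⟨t, ht.1.le⟩, rfl⟩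
  have h1 : (s : ℝ≥0∞) < criticalParameter J := by
    rw [← h]
    exact ENNReal.coe_lt_coe.2 (NNReal.coe_lt_coe.1 ht.2)
  exact hlt s h1 n hn Λ

end Critical

end LongRange

theorem proposition1p4 {d : ℕ} (hd : 1 ≤ d) (J : LongRange.Intensity d) {α c r₀ : ℝ}
    (hα : α < (d : ℝ) / 4) (hc : 0 < c)
    (hJ : ∀ x : LongRange.Lattice d, r₀ ≤ LongRange.l1norm x →
      c * LongRange.l1norm x ^ (-(d : ℝ) - α) ≤ J x) :
    (∃ C : ℝ, ∀ β : ℝ≥0, (β : ℝ≥0∞) ≤ LongRange.criticalParameter J → ∀ n : ℕ, 1 ≤ n →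
      (LongRange.percolation J β).real {ω | (n : ℕ∞) ≤ (LongRange.cluster ω 0).encard} ≤
        C * (n : ℝ) ^ (-(((d : ℝ) - 4 * α) / (4 * (d : ℝ))))) ∧
    LongRange.criticalParameter J ≠ ∞ ∧
    LongRange.NoInfiniteCluster J (LongRange.criticalParameter J).toNNReal := by
  obtain ⟨C, hC⟩ := LongRange.exists_volumeTail_le hd J hα hc hJ rfl
  set θ := ((d : ℝ) - 4 * α) / (4 * (d : ℝ)) with hθ
  have hd0 : (0 : ℝ) < d := by exact_mod_cast hd
  have hθ0 : 0 < θ := div_pos (by linarith) (by positivity)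
  have hdecay : Filter.Tendsto (fun n : ℕ => C * (n : ℝ) ^ (-θ)) Filter.atTop (nhds 0) := by
    simpa using ((tendsto_rpow_neg_atTop hθ0).comp tendsto_natCast_atTop_atTop).const_mul C
  have hfin : LongRange.criticalParameter J ≠ ∞ := by
    intro htop
    obtain ⟨n, hn, hn1⟩ := ((hdecay.eventually (gt_mem_nhds (show (0 : ℝ) < 1 / 2 by norm_num))).and
      (Filter.eventually_ge_atTop 1)).exists
    set r := max n ⌈r₀⌉₊ with hr
    have hrn : n ≤ r := le_max_left _ _
    have hr1 : 1 ≤ r := hn1.trans hrn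
    have hr0 : r₀ ≤ r := (Nat.le_ceil r₀).trans (by exact_mod_cast le_max_right _ _)
    have hZ : ∀ z ∈ LongRange.orthantBox d r, 0 < J z := fun z hz => by
      have h1 := LongRange.le_l1norm_of_mem_orthantBox hd hz
      have h2 : 0 < LongRange.l1norm z := lt_of_lt_of_le (by exact_mod_cast hr1) h1
      exact (mul_pos hc (Real.rpow_pos_of_pos h2 _)).trans_le (hJ z (hr0.trans h1))
    have hcard : n ≤ (LongRange.orthantBox d r).card := by
      rw [LongRange.card_orthantBox]
      exact hrn.trans (Nat.le_self_pow (by omega) r)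
    obtain ⟨β, Λ, hβ⟩ := LongRange.exists_volumeTail_gt J hZ hcard
      (show (1 / 2 : ℝ) < 1 by norm_num)
    have := hC β (htop ▸ le_top) n hn1 Λ 0
    linarith
  refine ⟨⟨C, fun β hβ n hn =>
    LongRange.percolation_real_le_of_volumeTail_le J β fun Λ => hC β hβ n hn Λ 0⟩, hfin, ?_⟩
  rw [LongRange.NoInfiniteCluster, ae_all_iff]
  intro x
  set β := (LongRange.criticalParameter J).toNNReal with hβ
  have hβc : (β : ℝ≥0∞) ≤ LongRange.criticalParameter J := ENNReal.coe_toNNReal_le_self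
  have hzero : (LongRange.percolation J β).real {ω | ¬(LongRange.cluster ω x).Finite} ≤ 0 := by
    refine ge_of_tendsto hdecay ?_
    filter_upwards [Filter.eventually_ge_atTop 1] with n hn
    refine (measureReal_mono fun ω hω => ?_).trans
      (LongRange.percolation_real_le_of_volumeTail_le J β fun Λ => hC β hβc n hn Λ x)
    have : (LongRange.cluster ω x).encard = ⊤ := Set.encard_eq_top hω
    change (n : ℕ∞) ≤ (LongRange.cluster ω x).encard
    rw [this]
    exact le_top
  rw [ae_iff]
  exact (measureReal_eq_zero_iff).1 (le_antisymm hzero measureReal_nonneg)
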